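/- Let $d\ge 0$ and let $M$ be a smooth (Hausdorff, second countable) manifold of dimension $2d+1$ without boundary. A *stable Hamiltonian structure* on $M$ is a pair $(\Omega,\alpha)$ consisting of a smooth closed 2-form $\Omega$ such that $\Omega^d$ vanishes nowhere, and a smooth 1-form $\alpha$ such that $\alpha\wedge\Omega^d$ vanishes nowhere and $\ker\Omega\subseteq\ker d\alpha$. Its *Reeb field* is the vector field $E$ with $i_E\Omega=0$ and $\alpha(E)=1$. **Theorem.** Let $(\Omega,\alpha)$ be a stable Hamiltonian structure on $M$. Then there is exactly one vector field $E$ on $M$ with $i_E\Omega=0$ and $\alpha(E)=1$, it is smooth, and the following hold. 1. There is a smooth torsion-free linear connection $\nabla$ on $TM$ with $$\nabla E=0,\qquad \nabla\Omega=0.$$ Such a connection is called an *shs connection*. 2. If $d\ge 1$ and $M$ is non-empty, there are infinitely many shs connections on $M$. 3. If $\Omega=d\alpha$ (the contact case), the shs connections are exactly Lichnerowicz's contact connections, that is, the smooth torsion-free linear connections $\nabla$ with $\nabla E=0$ and $\nabla\, d\alpha=0$. -/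

import Mathlib

open Bundle
open scoped Manifold ContDiff

noncomputable section

namespace StableHamiltonian

/-! ### Multilinear algebra -/

/-- The wedge product of two alternating forms,
`(f ∧ g)(v₁, …, v_{k+l}) = ∑ sgn(σ) f(v_{σ 1}, …, v_{σ k}) g(v_{σ (k+1)}, …, v_{σ (k+l)})`,
the sum being over all `(k, l)`-shuffles `σ`. -/
def wedge {V : Type*} [AddCommGroup V] [Module ℝ V] {k l : ℕ}
    (f : V [⋀^Fin k]→ₗ[ℝ] ℝ) (g : V [⋀^Fin l]→ₗ[ℝ] ℝ) : V [⋀^Fin (k + l)]→ₗ[ℝ] ℝ :=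
  ((LinearMap.mul' ℝ ℝ).compAlternatingMap (f.domCoprod g)).domDomCongr finSumFinEquiv

/-- The power `β ^ k = β ∧ ⋯ ∧ β` of a 2-form; `β ^ 0` is the constant `1`. -/
def wedgePow {V : Type*} [AddCommGroup V] [Module ℝ V] (β : V [⋀^Fin 2]→ₗ[ℝ] ℝ) :
    (k : ℕ) → V [⋀^Fin (2 * k)]→ₗ[ℝ] ℝ
  | 0 => haveI : IsEmpty (Fin (2 * 0)) := Fin.isEmpty
    AlternatingMap.constOfIsEmpty ℝ V (Fin (2 * 0)) (1 : ℝ)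
  | k + 1 => wedge (wedgePow β k) β

/-! ### Differential forms on a manifold of dimension `n` -/

section Forms

variable {n : ℕ} (M : Type*) [TopologicalSpace M] [ChartedSpace (EuclideanSpace ℝ (Fin n)) M]

/-- A (not necessarily smooth) differential `k`-form on `M`. -/
abbrev DiffForm (k : ℕ) : Type _ :=
  ∀ x : M, TangentSpace (𝓡 n) x [⋀^Fin k]→L[ℝ] ℝ

variable {M} {k : ℕ}

/-- The expression of a differential form in the preferred chart `φ` at `x₀`: its pull-back under
`φ⁻¹`, a differential form on the target of `φ` in `ℝⁿ`. -/
def DiffForm.inChart (β : DiffForm (n := n) M k) (x₀ : M) :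
    EuclideanSpace ℝ (Fin n) → EuclideanSpace ℝ (Fin n) [⋀^Fin k]→L[ℝ] ℝ :=
  fun y ↦ (β ((extChartAt (𝓡 n) x₀).symm y)).compContinuousLinearMap
    (mfderiv 𝓘(ℝ, EuclideanSpace ℝ (Fin n)) (𝓡 n) (extChartAt (𝓡 n) x₀).symm y)

/-- A differential form is smooth if it is smooth in charts. -/
def DiffForm.IsSmooth (β : DiffForm (n := n) M k) : Prop :=
  ∀ x₀ : M, ContDiffOn ℝ ∞ (DiffForm.inChart β x₀) (extChartAt (𝓡 n) x₀).target

/-- The exterior derivative of a differential form, computed at `x` in the chart at `x`. -/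
def DiffForm.extD (β : DiffForm (n := n) M k) : DiffForm (n := n) M (k + 1) :=
  fun x ↦ (extDeriv (β.inChart x) (extChartAt (𝓡 n) x x)).compContinuousLinearMap
    (mfderiv (𝓡 n) 𝓘(ℝ, EuclideanSpace ℝ (Fin n)) (extChartAt (𝓡 n) x) x)

end Forms

/-! ### Stable Hamiltonian structures -/

section Structures

variable {d : ℕ} {M : Type*} [TopologicalSpace M]
  [ChartedSpace (EuclideanSpace ℝ (Fin (2 * d + 1))) M]

/-- A Hamiltonian structure on a manifold of dimension `2d+1`: a closed 2-form `Ω` of maximal rank,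
that is, such that `Ω ^ d` vanishes nowhere. -/
structure IsHamiltonian (Ω : DiffForm (n := 2 * d + 1) M 2) : Prop where
  smooth : DiffForm.IsSmooth Ω
  closed : ∀ x, DiffForm.extD Ω x = 0
  pow_ne_zero : ∀ x, wedgePow (Ω x).toAlternatingMap d ≠ 0

/-- A stable Hamiltonian structure `(Ω, α)`: a Hamiltonian structure `Ω` with a 1-form `α` such that
`α ∧ Ω ^ d` vanishes nowhere and `ker Ω ⊆ ker dα`. -/
structure IsStableHamiltonian (Ω : DiffForm (n := 2 * d + 1) M 2)
    (α : DiffForm (n := 2 * d + 1) M 1) : Prop where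
  isHamiltonian : IsHamiltonian Ω
  smooth : DiffForm.IsSmooth α
  volume_ne_zero : ∀ x, wedge (α x).toAlternatingMap (wedgePow (Ω x).toAlternatingMap d) ≠ 0
  ker_le : ∀ x (u : TangentSpace (𝓡 (2 * d + 1)) x),
    (∀ w, Ω x ![u, w] = 0) → ∀ w, DiffForm.extD α x ![u, w] = 0

/-- `E` is the Reeb field of `(Ω, α)`: `i_E Ω = 0` and `i_E α = 1`. -/
def IsReebField (Ω : DiffForm (n := 2 * d + 1) M 2) (α : DiffForm (n := 2 * d + 1) M 1)
    (E : ∀ x : M, TangentSpace (𝓡 (2 * d + 1)) x) : Prop :=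
  ∀ x, (∀ w, Ω x ![E x, w] = 0) ∧ α x ![E x] = 1

end Structures

/-! ### Linear connections -/

section Connections

variable {n : ℕ} {M : Type*} [TopologicalSpace M] [ChartedSpace (EuclideanSpace ℝ (Fin n)) M]
  [IsManifold (𝓡 n) ∞ M]

variable (M) in
/-- A smooth vector field on `M`. -/
abbrev SmoothVectorField : Type _ :=
  ContMDiffSection (𝓡 n) (EuclideanSpace ℝ (Fin n)) ∞ (TangentSpace (𝓡 n) : M → Type _)

variable (M) in
/-- A Koszul connection on the tangent bundle of `M`; `nabla Y x u` is `(∇_u Y)(x)`. -/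
abbrev LinearConnection : Type _ :=
  CovariantDerivative (𝓡 n) (EuclideanSpace ℝ (Fin n)) (TangentSpace (𝓡 n) : M → Type _)

/-- `∇E = 0`. -/
def IsParallelField (nabla : LinearConnection (n := n) M)
    (E : ∀ x : M, TangentSpace (𝓡 n) x) : Prop :=
  ∀ x, nabla E x = 0

/-- `∇Ω = 0`, that is, `u(Ω(Y, Z)) = Ω(∇_u Y, Z) + Ω(Y, ∇_u Z)` for all smooth vector fields
`Y`, `Z` and all tangent vectors `u`. -/
def IsParallelForm (nabla : LinearConnection (n := n) M) (Ω : DiffForm (n := n) M 2) : Prop :=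
  ∀ (Y Z : SmoothVectorField (n := n) M) (x : M) (u : TangentSpace (𝓡 n) x),
    mfderiv (𝓡 n) 𝓘(ℝ, ℝ) (fun y ↦ Ω y ![Y y, Z y]) x u =
      Ω x ![nabla (fun y ↦ Y y) x u, Z x] + Ω x ![Y x, nabla (fun y ↦ Z y) x u]

/-- A smooth torsion-free linear connection with `∇E = 0` and `∇Ω = 0`. -/
structure IsShsConnection (Ω : DiffForm (n := n) M 2) (E : ∀ x : M, TangentSpace (𝓡 n) x)
    (nabla : LinearConnection (n := n) M) : Prop where
  smooth : nabla.ContMDiffCovariantDerivative ∞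
  torsion_eq_zero : nabla.torsion = 0
  parallel_field : IsParallelField nabla E
  parallel_form : IsParallelForm nabla Ω

/-- A contact connection for the contact form `α` with Reeb field `E`: a smooth torsion-free linear
connection with `∇E = 0` and `∇(dα) = 0`. -/
structure IsContactConnection (α : DiffForm (n := n) M 1) (E : ∀ x : M, TangentSpace (𝓡 n) x)
    (nabla : LinearConnection (n := n) M) : Prop where
  smooth : nabla.ContMDiffCovariantDerivative ∞
  torsion_eq_zero : nabla.torsion = 0
  parallel_field : IsParallelField nabla E
  parallel_form : IsParallelForm nabla (DiffForm.extD α)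

/-- The operator `Y ↦ ∇Y` on smooth vector fields. Two elements of `LinearConnection` are the same
connection in the usual sense precisely when these operators agree: the values of a
`CovariantDerivative` on non-differentiable sections are unconstrained and carry no meaning. -/
def onSmooth (nabla : LinearConnection (n := n) M) :
    SmoothVectorField (n := n) M →
      ∀ x : M, TangentSpace (𝓡 n) x →L[ℝ] TangentSpace (𝓡 n) x :=
  fun Y ↦ nabla (fun y ↦ Y y)

end Connections

end StableHamiltonian

end

noncomputable section

set_option maxSynthPendingDepth 3

/-! The conditions defining an shs connection are affine, so it suffices to solve them in each chart
and average the solutions with a partition of unity (`exists_local_christoffel`, `gluedConnection`).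
In a chart, write `β`, `a`, `e` for the expressions of Ω, α and the Reeb field. Non-vanishing of α ∧
Ω^d gives ker α ∩ ker Ω = 0, so β + a ⊗ a is invertible. Its inverse `P` sends `a` to `e`, which
makes the Reeb field smooth. Starting from the flat connection, a symmetric tensor `G` built from
`a` and De first makes `e` parallel. Let T = ∇β for this new connection. It is skew in its last two
slots, its cyclic sum vanishes because β is closed and the torsion is zero, and it vanishes when any
slot is `e`. The second correction (P T(u, v) + P T(v, u)) / 3, as in the classical symplectic case,
then removes T without disturbing the torsion or ∇e (`christoffel_identities`). For infinitude,
adding c (i_X Ω) ⊗ (i_X Ω) ⊗ X to one solution gives another for each real c. Where Ω(X, ·) ≠ 0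
these differ, and such an X exists when d ≥ 1. In the contact case the two sets of conditions
coincide after substituting Ω = dα. -/

namespace StableHamiltonian

/-! ### Multilinear algebra: the kernel of a 2-form and the Reeb vector. -/

section LinearAlgebra

variable {V : Type*} [AddCommGroup V] [Module ℝ V]

/-- If `f` and `g` vanish as soon as one of their arguments is `v`, so does `f ∧ g`. -/
theorem wedge_apply_eq_zero {k l : ℕ} (f : V [⋀^Fin k]→ₗ[ℝ] ℝ) (g : V [⋀^Fin l]→ₗ[ℝ] ℝ) (v : V)
    (hf : ∀ m : Fin k → V, (∃ i, m i = v) → f m = 0)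
    (hg : ∀ m : Fin l → V, (∃ i, m i = v) → g m = 0)
    (m : Fin (k + l) → V) (hm : ∃ i, m i = v) : wedge f g m = 0 := by
  obtain ⟨i, hi⟩ := hm
  simp only [wedge, AlternatingMap.domDomCongr_apply, LinearMap.compAlternatingMap_apply,
    AlternatingMap.domCoprod_apply, sum_apply, map_sum]
  refine Finset.sum_eq_zero fun σ _ ↦ ?_
  induction σ using Quotient.inductionOn' with
  | h σ =>
    simp only [AlternatingMap.domCoprod.summand_mk'', smul_apply,
      MultilinearMap.domDomCongr_apply, MultilinearMap.domCoprod_apply]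
    rw [map_zsmul_unit]
    -- In each shuffle the slot containing `v` is an argument of exactly one of the two factors, and
    -- that factor vanishes.
    rcases hj : σ.symm (finSumFinEquiv.symm i) with j | j
    · have : f (fun x ↦ m (finSumFinEquiv (σ (Sum.inl x)))) = 0 :=
        hf _ ⟨j, by simp [← hj, hi]⟩
      simp [this]
    · have : g (fun x ↦ m (finSumFinEquiv (σ (Sum.inr x)))) = 0 :=
        hg _ ⟨j, by simp [← hj, hi]⟩
      simp [this]

theorem apply_pair_swap (β : V [⋀^Fin 2]→ₗ[ℝ] ℝ) (v w : V) : β ![v, w] = -β ![w, v] := by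
  have h := β.map_swap ![v, w] (i := 0) (j := 1) (by decide)
  have e : ![v, w] ∘ (Equiv.swap (0 : Fin 2) 1) = ![w, v] := by
    ext i; fin_cases i <;> simp
  rw [e] at h
  rw [h, neg_neg]

/-- The bilinear form of an alternating 2-form. -/
def toBilin (β : V [⋀^Fin 2]→ₗ[ℝ] ℝ) : V →ₗ[ℝ] V →ₗ[ℝ] ℝ :=
  LinearMap.mk₂ ℝ (fun v w ↦ β ![v, w])
    (fun v v' w ↦ by simpa using β.map_vecCons_add ![w] v v')
    (fun c v w ↦ by simpa using β.map_vecCons_smul ![w] c v)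
    (fun v w w' ↦ by
      rw [apply_pair_swap β v, apply_pair_swap β v, apply_pair_swap β v, ← neg_add,
        β.map_vecCons_add ![v] w w'])
    (fun c v w ↦ by
      rw [apply_pair_swap β v, apply_pair_swap β v, smul_neg]
      simpa using β.map_vecCons_smul ![v] c w)

@[simp]
theorem toBilin_apply (β : V [⋀^Fin 2]→ₗ[ℝ] ℝ) (v w : V) : toBilin β v w = β ![v, w] := rfl

theorem apply_eq_zero_of_mem_kernel (β : V [⋀^Fin 2]→ₗ[ℝ] ℝ) (v : V)
    (hv : ∀ w, β ![v, w] = 0) (m : Fin 2 → V) (hm : ∃ i, m i = v) : β m = 0 := by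
  have key : m = ![m 0, m 1] := by ext i; fin_cases i <;> rfl
  obtain ⟨i, hi⟩ := hm
  rw [key]
  fin_cases i
  · simpa [← hi] using hv (m 1)
  · have h := hv (m 0)
    rw [apply_pair_swap, ← hi, neg_eq_zero] at h
    exact h

theorem wedgePow_apply_eq_zero (β : V [⋀^Fin 2]→ₗ[ℝ] ℝ) (v : V) (hv : ∀ w, β ![v, w] = 0) :
    ∀ (k : ℕ) (m : Fin (2 * k) → V), (∃ i, m i = v) → wedgePow β k m = 0
  | 0, _, ⟨i, _⟩ => (Nat.not_lt_zero _ i.2).elim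
  | k + 1, m, hm => wedge_apply_eq_zero _ _ v (wedgePow_apply_eq_zero β v hv k)
      (apply_eq_zero_of_mem_kernel β v hv) m hm

/-- If `a ∧ β ^ d ≠ 0` in dimension `2 d + 1`, then `ker a ∩ ker β = 0`. -/
theorem eq_zero_of_wedge_ne_zero {d : ℕ} [FiniteDimensional ℝ V]
    (hV : Module.finrank ℝ V = 2 * d + 1) (a : V [⋀^Fin 1]→ₗ[ℝ] ℝ) (β : V [⋀^Fin 2]→ₗ[ℝ] ℝ)
    (h : wedge a (wedgePow β d) ≠ 0) (v : V) (hβ : ∀ w, β ![v, w] = 0) (ha : a ![v] = 0) :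
    v = 0 := by
  by_contra hv
  apply h
  have hli : LinearIndepOn ℝ id ({v} : Set V) := LinearIndepOn.singleton hv
  let b := Module.Basis.extend hli
  have hmem : v ∈ hli.extend (Set.subset_univ _) := hli.subset_extend _ rfl
  have : Fintype (hli.extend (Set.subset_univ ({v} : Set V))) := FiniteDimensional.fintypeBasisIndex b
  refine Module.Basis.ext_alternating b fun c hc ↦ ?_
  have hcard : Fintype.card (Fin (1 + 2 * d)) =
      Fintype.card (hli.extend (Set.subset_univ ({v} : Set V))) := by
    rw [← Module.finrank_eq_card_basis b, hV, Fintype.card_fin, add_comm]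
  -- On a basis containing `v`, an injective choice of 2d + 1 basis vectors exhausts the basis, so
  -- `v` occurs among the arguments.
  obtain ⟨i, hi⟩ := ((Fintype.bijective_iff_injective_and_card c).2 ⟨hc, hcard⟩).2 ⟨v, hmem⟩
  rw [AlternatingMap.zero_apply]
  refine wedge_apply_eq_zero _ _ v ?_ (wedgePow_apply_eq_zero β v hβ d) _ ⟨i, ?_⟩
  · rintro m ⟨j, rfl⟩
    convert ha
    ext k; fin_cases k; fin_cases j; rfl
  · rw [hi]; exact Module.Basis.extend_apply_self hli ⟨v, hmem⟩

/-- An alternating bilinear form on an odd-dimensional space is degenerate. -/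
theorem exists_kernel_vector_of_odd {d : ℕ} [FiniteDimensional ℝ V]
    (hV : Module.finrank ℝ V = 2 * d + 1) (β : V [⋀^Fin 2]→ₗ[ℝ] ℝ) :
    ∃ v ≠ 0, ∀ w, β ![v, w] = 0 := by
  let b := Module.finBasisOfFinrankEq ℝ V hV
  let B := toBilin β
  have hB : ∀ v w, B v w = - B w v := apply_pair_swap β
  let A := LinearMap.toMatrix₂ b b B
  have hA : A.transpose = -A := by
    ext i j
    simp [A, LinearMap.toMatrix₂_apply, hB (b j) (b i)]
  -- det A = det Aᵀ = det(-A) = (-1)^(2d+1) det A = -det A.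
  have hdet : A.det = 0 := by
    have := A.det_transpose
    rw [hA, Matrix.det_neg, Fintype.card_fin, Odd.neg_one_pow ⟨d, rfl⟩] at this
    linarith
  obtain ⟨x, hx0, hx⟩ := Matrix.exists_vecMul_eq_zero_iff.2 hdet
  refine ⟨b.equivFun.symm x, (map_ne_zero_iff _ b.equivFun.symm.injective).2 hx0, fun w ↦ ?_⟩
  suffices h : B (b.equivFun.symm x) = 0 from LinearMap.congr_fun h w
  refine b.ext fun j ↦ ?_
  have := congrFun hx j
  simpa [Matrix.vecMul, dotProduct, A, LinearMap.toMatrix₂_apply,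
    Module.Basis.equivFun_symm_apply] using this

/-- Odd dimension supplies a nonzero kernel vector of `β`; non-degeneracy forces `a` to be nonzero
on it, so it can be rescaled. -/
theorem exists_reeb_vector {d : ℕ} [FiniteDimensional ℝ V]
    (hV : Module.finrank ℝ V = 2 * d + 1) (a : V [⋀^Fin 1]→ₗ[ℝ] ℝ) (β : V [⋀^Fin 2]→ₗ[ℝ] ℝ)
    (h : wedge a (wedgePow β d) ≠ 0) : ∃ v, (∀ w, β ![v, w] = 0) ∧ a ![v] = 1 := by
  obtain ⟨v, hv, hβ⟩ := exists_kernel_vector_of_odd hV β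
  have ha : a ![v] ≠ 0 := fun ha ↦ hv (eq_zero_of_wedge_ne_zero hV a β h v hβ ha)
  refine ⟨(a ![v])⁻¹ • v, fun w ↦ ?_, ?_⟩
  · rw [β.map_vecCons_smul, hβ, smul_zero]
  · rw [a.map_vecCons_smul, smul_eq_mul, inv_mul_cancel₀ ha]

end LinearAlgebra

/-! ### The local problem: Christoffel tensors on an open subset of a vector space. -/

section Local

variable {F : Type*} [NormedAddCommGroup F] [NormedSpace ℝ F]

/-- The bilinear form `β + a ⊗ a`. -/
def pairing (β : F →L[ℝ] F →L[ℝ] ℝ) (a : F →L[ℝ] ℝ) : F →L[ℝ] F →L[ℝ] ℝ :=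
  β + a.smulRight a

theorem pairing_apply (β : F →L[ℝ] F →L[ℝ] ℝ) (a : F →L[ℝ] ℝ) (u v : F) :
    pairing β a u v = β u v + a u * a v := by simp [pairing]

theorem isInvertible_pairing [FiniteDimensional ℝ F] {β : F →L[ℝ] F →L[ℝ] ℝ} {a : F →L[ℝ] ℝ}
    (hβ : ∀ u v, β u v = -β v u) (h : ∀ v, β v = 0 → a v = 0 → v = 0) :
    (pairing β a).IsInvertible := by
  have hinj : Function.Injective (pairing β a) := by
    refine (injective_iff_map_eq_zero _).2 fun v hv ↦ ?_
    have hv' : ∀ w, β v w + a v * a w = 0 := fun w ↦ by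
      rw [← pairing_apply, hv, zero_apply]
    -- Pairing `v` with itself leaves only the square of `a v`, since `β` is skew.
    have hvv : a v = 0 := by
      have h1 := hv' v
      have h2 := hβ v v
      have : a v * a v = 0 := by linarith
      simpa using this
    exact h v (by ext w; simpa [hvv] using hv' w) hvv
  have hfin : Module.finrank ℝ F = Module.finrank ℝ (F →L[ℝ] ℝ) := by
    rw [← LinearMap.toContinuousLinearMap.finrank_eq]
    exact Subspace.dual_finrank_eq.symm
  let e := LinearEquiv.ofInjectiveOfFinrankEq (pairing β a : F →ₗ[ℝ] (F →L[ℝ] ℝ)) hinj hfin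
  refine ⟨e.toContinuousLinearEquiv, ?_⟩
  ext u v
  rfl

theorem inverse_pairing_eq [FiniteDimensional ℝ F] {β : F →L[ℝ] F →L[ℝ] ℝ} {a : F →L[ℝ] ℝ}
    (h : (pairing β a).IsInvertible) {e : F} (he : β e = 0) (hae : a e = 1) :
    (pairing β a).inverse a = e := by
  rw [h.inverse_apply_eq]
  ext w
  simp [pairing_apply, he, hae]

variable [FiniteDimensional ℝ F] {T : Set F} {β : F → F →L[ℝ] F →L[ℝ] ℝ} {a : F → F →L[ℝ] ℝ}

theorem contDiffOn_inverse_pairing (hβ : ContDiffOn ℝ ∞ β T) (ha : ContDiffOn ℝ ∞ a T)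
    (h : ∀ y ∈ T, (pairing (β y) (a y)).IsInvertible) :
    ContDiffOn ℝ ∞ (fun y ↦ (pairing (β y) (a y)).inverse) T := by
  intro y hy
  refine ContDiffAt.comp_contDiffWithinAt (f := fun y ↦ pairing (β y) (a y)) y
    (h y hy).contDiffAt_map_inverse ?_
  exact (hβ y hy).add ((ha y hy).smulRight (ha y hy))

/-- The Reeb field is the preimage of `a` under β + a ⊗ a, and inversion of operators is smooth. -/
theorem contDiffOn_reeb (hβ : ContDiffOn ℝ ∞ β T) (ha : ContDiffOn ℝ ∞ a T)
    (h : ∀ y ∈ T, (pairing (β y) (a y)).IsInvertible) {e : F → F}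
    (he : ∀ y ∈ T, β y (e y) = 0) (hae : ∀ y ∈ T, a y (e y) = 1) : ContDiffOn ℝ ∞ e T :=
  ((contDiffOn_inverse_pairing hβ ha h).clm_apply ha).congr fun y hy ↦
    (inverse_pairing_eq (h y hy) (he y hy) (hae y hy)).symm

/-- The symmetric correction `-(a ⊗ A + A ⊗ a) + a ⊗ a ⊗ A e`, which makes `e` parallel when
`A` is the derivative of `e`. -/
def fieldCorrection (a : F →L[ℝ] ℝ) (A : F →L[ℝ] F) (e : F) : F →L[ℝ] F →L[ℝ] F :=
  -(a.smulRight A + (a.smulRight A).flip) + a.smulRight (a.smulRight (A e))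

omit [FiniteDimensional ℝ F] in
theorem fieldCorrection_apply (a : F →L[ℝ] ℝ) (A : F →L[ℝ] F) (e u v : F) :
    fieldCorrection a A e u v = -(a u • A v + a v • A u) + a u • a v • A e := by
  simp [fieldCorrection]

/-- The covariant derivative of `β` for the connection with Christoffel tensor `G`, where `D` is
the derivative of `β`. -/
def formDefect (D : F →L[ℝ] F →L[ℝ] F →L[ℝ] ℝ) (β : F →L[ℝ] F →L[ℝ] ℝ)
    (G : F →L[ℝ] F →L[ℝ] F) : F →L[ℝ] F →L[ℝ] F →L[ℝ] ℝ :=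
  D - (ContinuousLinearMap.compL ℝ F F (F →L[ℝ] ℝ) β).comp G +
    (ContinuousLinearMap.flipₗᵢ ℝ F F ℝ : (F →L[ℝ] F →L[ℝ] ℝ) →L[ℝ] (F →L[ℝ] F →L[ℝ] ℝ)).comp
      ((ContinuousLinearMap.compL ℝ F F (F →L[ℝ] ℝ) β).comp G)

omit [FiniteDimensional ℝ F] in
theorem formDefect_apply (D : F →L[ℝ] F →L[ℝ] F →L[ℝ] ℝ) (β : F →L[ℝ] F →L[ℝ] ℝ)
    (G : F →L[ℝ] F →L[ℝ] F) (u v w : F) :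
    formDefect D β G u v w = D u v w - β (G u v) w + β (G u w) v := by
  simp [formDefect]

/-- The symmetrization `(P⁻¹ T(u, v) + P⁻¹ T(v, u)) / 3`. -/
def formCorrection (P : (F →L[ℝ] ℝ) →L[ℝ] F) (T : F →L[ℝ] F →L[ℝ] F →L[ℝ] ℝ) :
    F →L[ℝ] F →L[ℝ] F :=
  (1 / 3 : ℝ) • ((ContinuousLinearMap.compL ℝ F (F →L[ℝ] ℝ) F P).comp T +
    ((ContinuousLinearMap.compL ℝ F (F →L[ℝ] ℝ) F P).comp T).flip)

omit [FiniteDimensional ℝ F] in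
theorem formCorrection_apply (P : (F →L[ℝ] ℝ) →L[ℝ] F) (T : F →L[ℝ] F →L[ℝ] F →L[ℝ] ℝ)
    (u v : F) : formCorrection P T u v = (1 / 3 : ℝ) • (P (T u v) + P (T v u)) := by
  simp [formCorrection]

omit [FiniteDimensional ℝ F] in
/-- Pointwise solution of the equations for the Christoffel tensor of an shs connection. -/
theorem christoffel_identities {β : F →L[ℝ] F →L[ℝ] ℝ} {a : F →L[ℝ] ℝ}
    {D : F →L[ℝ] F →L[ℝ] F →L[ℝ] ℝ} {A : F →L[ℝ] F} {e : F}
    (hβ : ∀ u v, β u v = -β v u) (hD : ∀ u v w, D u v w = -D u w v)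
    (hcyc : ∀ u v w, D u v w + D v w u + D w u v = 0)
    (hDe : ∀ u w, D u e w + β (A u) w = 0)
    (hP : (pairing β a).IsInvertible) (he : β e = 0) (hae : a e = 1) :
    let G := fieldCorrection a A e
    let G' := formCorrection (pairing β a).inverse (formDefect D β G)
    (∀ u v, (G + G') u v = (G + G') v u) ∧ (∀ u, A u + (G + G') u e = 0) ∧
      ∀ u v w, D u v w = β ((G + G') u v) w + β v ((G + G') u w) := by
  intro G G'
  have hGsymm : ∀ u v, G u v = G v u := fun u v ↦ by
    simp only [G, fieldCorrection_apply]; module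
  -- With a(e) = 1, the term a ⊗ a ⊗ A e cancels the surplus -a(u) A e, leaving G(u, e) = -A u.
  have hGe : ∀ u, A u + G u e = 0 := fun u ↦ by
    simp only [G, fieldCorrection_apply, hae]; module
  set T := formDefect D β G with hT
  have hTapply : ∀ u v w, T u v w = D u v w - β (G u v) w + β (G u w) v :=
    formDefect_apply D β G
  have hTanti : ∀ u v w, T u v w = -T u w v := fun u v w ↦ by
    rw [hTapply, hTapply, hD u v w]; ring
  -- The `G` terms cancel in the cyclic sum because `G` is symmetric; what remains is closedness of
  -- β.
  have hTcyc : ∀ u v w, T u v w + T v w u + T w u v = 0 := fun u v w ↦ by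
    have := hcyc u v w
    rw [hTapply, hTapply, hTapply, hGsymm v u, hGsymm w u, hGsymm w v]; linarith
  have hβe : ∀ u, β u e = 0 := fun u ↦ by rw [hβ, he]; simp
  have hTe : ∀ u, T u e = 0 := fun u ↦ by
    ext w
    have h1 := hDe u w
    have h2 : G u e = -A u := by rw [← add_eq_zero_iff_eq_neg', hGe]
    rw [hTapply, hβe, h2]
    simp only [map_neg, neg_apply, zero_apply]
    linarith
  -- In the cyclic identity for (e, u, w) the other two terms have `e` in the second or third slot,
  -- hence vanish.
  have hTe' : ∀ u, T e u = 0 := fun u ↦ by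
    ext w
    have h1 := hTcyc e u w
    rw [hTe w, hTanti u w e, hTe u] at h1
    simpa using h1
  set P := (pairing β a).inverse with hPdef
  -- `P` inverts β + a ⊗ a, not β. Evaluating at `e` gives a(P T(u, v)) = T(u, v, e) = 0, so the
  -- extra term drops out.
  have hPT : ∀ u v w, β (P (T u v)) w = T u v w := fun u v w ↦ by
    have h1 : pairing β a (P (T u v)) = T u v := hP.self_apply_inverse _
    have h2 : a (P (T u v)) = 0 := by
      have := congrArg (fun l ↦ l e) h1
      simp only [pairing_apply, hae, hβe] at this
      rw [hTanti, hTe] at this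
      simpa using this
    have := congrArg (fun l ↦ l w) h1
    simpa [pairing_apply, h2] using this
  have hG' : ∀ u v, G' u v = (1 / 3 : ℝ) • (P (T u v) + P (T v u)) := formCorrection_apply P T
  refine ⟨fun u v ↦ ?_, fun u ↦ ?_, fun u v w ↦ ?_⟩
  · simp only [add_apply, hG', hGsymm u v, add_comm (P (T u v))]
  · simp only [add_apply, hG', hTe, hTe', map_zero, add_zero, smul_zero, hGe]
  · have h1 : β ((G + G') u v) w = β (G u v) w + 1 / 3 * (T u v w + T v u w) := by
      simp [hG', hPT]; ring
    have h2 : β v ((G + G') u w) = -(β (G u w) v + 1 / 3 * (T u w v + T w u v)) := by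
      rw [hβ]; simp [hG', hPT]; ring
    -- After both corrections the defect equals one third of the cyclic sum of T; this dictates the
    -- factor 1/3.
    have h3 := hTapply u v w
    have h4 := hTcyc u v w
    have h5 := hTanti u w v
    have h6 := hTanti v w u
    rw [h1, h2]
    linarith

/-- Local existence of the Christoffel tensor of an shs connection. -/
theorem exists_christoffel (hT : IsOpen T) (hβ : ContDiffOn ℝ ∞ β T) (ha : ContDiffOn ℝ ∞ a T)
    {e : F → F} (hanti : ∀ y u v, β y u v = -β y v u)
    (hcyc : ∀ y ∈ T, ∀ u v w,
      fderiv ℝ β y u v w + fderiv ℝ β y v w u + fderiv ℝ β y w u v = 0)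
    (hnd : ∀ y ∈ T, ∀ v, β y v = 0 → a y v = 0 → v = 0)
    (he : ∀ y ∈ T, β y (e y) = 0) (hae : ∀ y ∈ T, a y (e y) = 1) :
    ContDiffOn ℝ ∞ e T ∧ ∃ Γ : F → F →L[ℝ] F →L[ℝ] F, ContDiffOn ℝ ∞ Γ T ∧ ∀ y ∈ T,
      (∀ u v, Γ y u v = Γ y v u) ∧ (∀ u, fderiv ℝ e y u + Γ y u (e y) = 0) ∧
      ∀ u v w, fderiv ℝ β y u v w = β y (Γ y u v) w + β y v (Γ y u w) := by
  have hinv : ∀ y ∈ T, (pairing (β y) (a y)).IsInvertible := fun y hy ↦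
    isInvertible_pairing (hanti y) (hnd y hy)
  have hesm : ContDiffOn ℝ ∞ e T := contDiffOn_reeb hβ ha hinv he hae
  have hPsm := contDiffOn_inverse_pairing hβ ha hinv
  have hDβ : ContDiffOn ℝ ∞ (fderiv ℝ β) T := hβ.fderiv_of_isOpen hT (by simp)
  have hDe : ContDiffOn ℝ ∞ (fderiv ℝ e) T := hesm.fderiv_of_isOpen hT (by simp)
  set G : F → F →L[ℝ] F →L[ℝ] F := fun y ↦ fieldCorrection (a y) (fderiv ℝ e y) (e y) with hGdef
  have hGsm : ContDiffOn ℝ ∞ G T := by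
    refine contDiffOn_clm_apply.2 fun u ↦ contDiffOn_clm_apply.2 fun v ↦ ?_
    simp only [G, fieldCorrection_apply]
    have c := fun u : F ↦ contDiffOn_const (𝕜 := ℝ) (n := ∞) (s := T) (c := u)
    exact (((ha.clm_apply (c u)).smul (hDe.clm_apply (c v))).add
      ((ha.clm_apply (c v)).smul (hDe.clm_apply (c u)))).neg.add
      ((ha.clm_apply (c u)).smul ((ha.clm_apply (c v)).smul (hDe.clm_apply hesm)))
  set D : F → F →L[ℝ] F →L[ℝ] F →L[ℝ] ℝ := fun y ↦ formDefect (fderiv ℝ β y) (β y) (G y)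
  have hDsm : ContDiffOn ℝ ∞ D T := by
    refine contDiffOn_clm_apply.2 fun u ↦ contDiffOn_clm_apply.2 fun v ↦
      contDiffOn_clm_apply.2 fun w ↦ ?_
    simp only [D, formDefect_apply]
    have c := fun u : F ↦ contDiffOn_const (𝕜 := ℝ) (n := ∞) (s := T) (c := u)
    exact ((((hDβ.clm_apply (c u)).clm_apply (c v)).clm_apply (c w)).sub
      ((hβ.clm_apply ((hGsm.clm_apply (c u)).clm_apply (c v))).clm_apply (c w))).add
      ((hβ.clm_apply ((hGsm.clm_apply (c u)).clm_apply (c w))).clm_apply (c v))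
  refine ⟨hesm, fun y ↦ G y + formCorrection (pairing (β y) (a y)).inverse (D y), ?_, ?_⟩
  · refine hGsm.add ?_
    refine contDiffOn_clm_apply.2 fun u ↦ contDiffOn_clm_apply.2 fun v ↦ ?_
    simp only [formCorrection_apply]
    have c := fun u : F ↦ contDiffOn_const (𝕜 := ℝ) (n := ∞) (s := T) (c := u)
    exact contDiffOn_const.smul ((hPsm.clm_apply ((hDsm.clm_apply (c u)).clm_apply (c v))).add
      (hPsm.clm_apply ((hDsm.clm_apply (c v)).clm_apply (c u))))
  · intro y hy
    have hy' : T ∈ nhds y := hT.mem_nhds hy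
    have dβ : DifferentiableAt ℝ β y := (hβ.contDiffAt hy').differentiableAt (by simp)
    have de : DifferentiableAt ℝ e y := (hesm.contDiffAt hy').differentiableAt (by simp)
    have eval : ∀ u v w, fderiv ℝ β y u v w = fderiv ℝ (fun z ↦ β z v w) y u := fun u v w ↦ by
      have h1 : HasFDerivAt (fun z ↦ β z v w) _ y :=
        (dβ.hasFDerivAt.clm_apply (hasFDerivAt_const v y)).clm_apply (hasFDerivAt_const w y)
      rw [h1.fderiv]; simp
    refine christoffel_identities (hanti y) (fun u v w ↦ ?_) (hcyc y hy) (fun u w ↦ ?_)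
      (hinv y hy) (he y hy) (hae y hy)
    · rw [eval, eval, show (fun z ↦ β z v w) = fun z ↦ -(β z w v) from funext fun z ↦ hanti z v w,
        fderiv_fun_neg]
      rfl
    -- The identity (D_u β)(e, w) + β(D_u e, w) = 0 comes from differentiating β(e, w) = 0, valid
    -- near `y` since `T` is open.
    · have h1 : HasFDerivAt (fun z ↦ β z (e z) w) _ y :=
        (dβ.hasFDerivAt.clm_apply de.hasFDerivAt).clm_apply (hasFDerivAt_const w y)
      have h2 : (fun z ↦ β z (e z) w) =ᶠ[nhds y] fun _ ↦ 0 := by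
        filter_upwards [hy'] with z hz
        simp [he z hz]
      have h3 := congrArg (fun l ↦ l u) (h1.fderiv.symm.trans (h2.fderiv_eq.trans
        (fderiv_fun_const (𝕜 := ℝ) (E := F) (0 : ℝ) ▸ rfl : _ = (0 : F →L[ℝ] ℝ))))
      simp at h3
      linarith

end Local

/-! ### Vector fields, functions and Lie brackets read in a chart. -/

section Charts

open Set Topology VectorField

variable {E : Type*} [NormedAddCommGroup E] [NormedSpace ℝ E]
  {M : Type*} [TopologicalSpace M] [ChartedSpace E M] [IsManifold 𝓘(ℝ, E) ∞ M]

/-- The derivative at `x` of the preferred chart at `x₀`, as a map to the model space. -/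
def chartD (x₀ x : M) : TangentSpace 𝓘(ℝ, E) x →L[ℝ] E :=
  (trivializationAt E (TangentSpace 𝓘(ℝ, E)) x₀).continuousLinearMapAt ℝ x

/-- The inverse of `chartD x₀ x`. -/
def chartDInv (x₀ x : M) : E →L[ℝ] TangentSpace 𝓘(ℝ, E) x :=
  (trivializationAt E (TangentSpace 𝓘(ℝ, E)) x₀).symmL ℝ x

/-- The expression of a vector field in the preferred chart at `x₀`. -/
def chartField (x₀ : M) (σ : ∀ x : M, TangentSpace 𝓘(ℝ, E) x) (y : E) : E :=
  chartD x₀ ((extChartAt 𝓘(ℝ, E) x₀).symm y) (σ ((extChartAt 𝓘(ℝ, E) x₀).symm y))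

variable {x₀ x : M}

omit [IsManifold 𝓘(ℝ, E) ∞ M] in
theorem mem_chart_source (hx : x ∈ (extChartAt 𝓘(ℝ, E) x₀).source) :
    x ∈ (chartAt E x₀).source := by
  rwa [← extChartAt_source 𝓘(ℝ, E)]

theorem chartDInv_chartD (hx : x ∈ (extChartAt 𝓘(ℝ, E) x₀).source)
    (v : TangentSpace 𝓘(ℝ, E) x) : chartDInv x₀ x (chartD x₀ x v) = v :=
  Trivialization.symmL_continuousLinearMapAt _ (mem_chart_source hx) v

theorem chartD_chartDInv (hx : x ∈ (extChartAt 𝓘(ℝ, E) x₀).source) (v : E) :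
    chartD x₀ x (chartDInv x₀ x v) = v :=
  Trivialization.continuousLinearMapAt_symmL _ (mem_chart_source hx) v

theorem chartD_eq_mfderiv (hx : x ∈ (extChartAt 𝓘(ℝ, E) x₀).source) :
    chartD x₀ x = mfderiv 𝓘(ℝ, E) 𝓘(ℝ, E) (extChartAt 𝓘(ℝ, E) x₀) x :=
  TangentBundle.continuousLinearMapAt_trivializationAt (mem_chart_source hx)

/-- Bridges two descriptions of the chart's differential: forms are pulled back by `mfderiv`, while
vector fields are read through bundle trivializations. -/
theorem mfderiv_extChartAt_symm_apply {y : E} (hy : y ∈ (extChartAt 𝓘(ℝ, E) x₀).target) (v : E) :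
    mfderiv 𝓘(ℝ, E) 𝓘(ℝ, E) (extChartAt 𝓘(ℝ, E) x₀).symm y v =
      chartDInv x₀ ((extChartAt 𝓘(ℝ, E) x₀).symm y) v := by
  have hx := (extChartAt 𝓘(ℝ, E) x₀).map_target hy
  have h := congrArg (fun l ↦ l v) (mfderiv_extChartAt_comp_mfderivWithin_extChartAt_symm hy)
  simp only [modelWithCornersSelf_coe, range_id, mfderivWithin_univ] at h
  rw [← chartDInv_chartD hx (mfderiv 𝓘(ℝ, E) 𝓘(ℝ, E) (extChartAt 𝓘(ℝ, E) x₀).symm y v)]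
  congr 1
  rw [chartD_eq_mfderiv hx]
  exact h

theorem chartField_extChartAt (hx : x ∈ (extChartAt 𝓘(ℝ, E) x₀).source)
    (σ : ∀ x : M, TangentSpace 𝓘(ℝ, E) x) :
    chartField x₀ σ (extChartAt 𝓘(ℝ, E) x₀ x) = chartD x₀ x (σ x) := by
  rw [chartField, (extChartAt 𝓘(ℝ, E) x₀).left_inv hx]

theorem chartField_eq_mpullback (σ : ∀ x : M, TangentSpace 𝓘(ℝ, E) x) {y : E}
    (hy : y ∈ (extChartAt 𝓘(ℝ, E) x₀).target) :
    chartField x₀ σ y = mpullback 𝓘(ℝ, E) 𝓘(ℝ, E) (extChartAt 𝓘(ℝ, E) x₀).symm σ y := by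
  have hinv : (mfderiv 𝓘(ℝ, E) 𝓘(ℝ, E) (extChartAt 𝓘(ℝ, E) x₀).symm y).IsInvertible := by
    simpa using isInvertible_mfderivWithin_extChartAt_symm (I := 𝓘(ℝ, E)) hy
  refine (hinv.inverse_apply_eq.2 ?_).symm
  exact ((mfderiv_extChartAt_symm_apply hy _).trans
    (chartDInv_chartD ((extChartAt 𝓘(ℝ, E) x₀).map_target hy) _)).symm

omit [IsManifold 𝓘(ℝ, E) ∞ M] in
theorem chart_target_mem_nhds (hx : x ∈ (extChartAt 𝓘(ℝ, E) x₀).source) :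
    (extChartAt 𝓘(ℝ, E) x₀).target ∈ 𝓝 (extChartAt 𝓘(ℝ, E) x₀ x) :=
  (isOpen_extChartAt_target x₀).mem_nhds ((extChartAt 𝓘(ℝ, E) x₀).map_source hx)

section Functions

variable {G : Type*} [NormedAddCommGroup G] [NormedSpace ℝ G] {g : M → G} {h : E → G}

/-- A function agreeing near `x` with the pull-back of a smooth function by a chart is smooth. -/
theorem contMDiffAt_of_chart {k : ℕ∞ω} (hk : k ≤ ∞)
    (hx : x ∈ (extChartAt 𝓘(ℝ, E) x₀).source)
    (hg : ∀ z ∈ (extChartAt 𝓘(ℝ, E) x₀).source, g z = h (extChartAt 𝓘(ℝ, E) x₀ z))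
    (hh : ContDiffAt ℝ k h (extChartAt 𝓘(ℝ, E) x₀ x)) : ContMDiffAt 𝓘(ℝ, E) 𝓘(ℝ, G) k g x := by
  have h1 : ContMDiffAt 𝓘(ℝ, E) 𝓘(ℝ, G) k (h ∘ extChartAt 𝓘(ℝ, E) x₀) x :=
    hh.contMDiffAt.comp x
      ((contMDiffAt_extChartAt' (n := ∞) (mem_chart_source hx)).of_le hk)
  exact h1.congr_of_eventuallyEq (by
    filter_upwards [extChartAt_source_mem_nhds' hx] with z hz using hg z hz)

theorem contDiffAt_of_chart {k : ℕ∞ω} (hk : k ≤ ∞)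
    (hx : x ∈ (extChartAt 𝓘(ℝ, E) x₀).source)
    (hg : ∀ z ∈ (extChartAt 𝓘(ℝ, E) x₀).source, g z = h (extChartAt 𝓘(ℝ, E) x₀ z))
    (hh : ContMDiffAt 𝓘(ℝ, E) 𝓘(ℝ, G) k g x) : ContDiffAt ℝ k h (extChartAt 𝓘(ℝ, E) x₀ x) := by
  have hy := (extChartAt 𝓘(ℝ, E) x₀).map_source hx
  have h0 : ContMDiffAt 𝓘(ℝ, E) 𝓘(ℝ, E) k (extChartAt 𝓘(ℝ, E) x₀).symm
      (extChartAt 𝓘(ℝ, E) x₀ x) :=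
    (((contMDiffOn_extChartAt_symm (n := ∞) x₀).contMDiffAt (chart_target_mem_nhds hx)).of_le hk)
  have h1 : ContMDiffAt 𝓘(ℝ, E) 𝓘(ℝ, G) k (g ∘ (extChartAt 𝓘(ℝ, E) x₀).symm)
      (extChartAt 𝓘(ℝ, E) x₀ x) :=
    ContMDiffAt.comp_of_eq (f := (extChartAt 𝓘(ℝ, E) x₀).symm) hh h0
      ((extChartAt 𝓘(ℝ, E) x₀).left_inv hx)
  refine (h1.congr_of_eventuallyEq ?_).contDiffAt
  filter_upwards [chart_target_mem_nhds hx] with z hz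
  rw [Function.comp_apply, hg _ ((extChartAt 𝓘(ℝ, E) x₀).map_target hz),
    (extChartAt 𝓘(ℝ, E) x₀).right_inv hz]

theorem differentiableAt_of_chart (hx : x ∈ (extChartAt 𝓘(ℝ, E) x₀).source)
    (hg : ∀ z ∈ (extChartAt 𝓘(ℝ, E) x₀).source, g z = h (extChartAt 𝓘(ℝ, E) x₀ z))
    (hh : MDifferentiableAt 𝓘(ℝ, E) 𝓘(ℝ, G) g x) :
    DifferentiableAt ℝ h (extChartAt 𝓘(ℝ, E) x₀ x) := by
  have h0 : MDifferentiableAt 𝓘(ℝ, E) 𝓘(ℝ, E) (extChartAt 𝓘(ℝ, E) x₀).symm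
      (extChartAt 𝓘(ℝ, E) x₀ x) :=
    ((contMDiffOn_extChartAt_symm (n := ∞) x₀).contMDiffAt
      (chart_target_mem_nhds hx)).mdifferentiableAt (by simp)
  have h1 : MDifferentiableAt 𝓘(ℝ, E) 𝓘(ℝ, G) (g ∘ (extChartAt 𝓘(ℝ, E) x₀).symm)
      (extChartAt 𝓘(ℝ, E) x₀ x) :=
    MDifferentiableAt.comp_of_eq (f := (extChartAt 𝓘(ℝ, E) x₀).symm) (x := _) hh h0
      ((extChartAt 𝓘(ℝ, E) x₀).left_inv hx)
  refine (h1.congr_of_eventuallyEq ?_).differentiableAt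
  filter_upwards [chart_target_mem_nhds hx] with z hz
  rw [Function.comp_apply, hg _ ((extChartAt 𝓘(ℝ, E) x₀).map_target hz),
    (extChartAt 𝓘(ℝ, E) x₀).right_inv hz]

theorem mfderiv_of_chart (hx : x ∈ (extChartAt 𝓘(ℝ, E) x₀).source)
    (hg : ∀ z ∈ (extChartAt 𝓘(ℝ, E) x₀).source, g z = h (extChartAt 𝓘(ℝ, E) x₀ z))
    (hh : DifferentiableAt ℝ h (extChartAt 𝓘(ℝ, E) x₀ x)) (u : TangentSpace 𝓘(ℝ, E) x) :
    mfderiv 𝓘(ℝ, E) 𝓘(ℝ, G) g x u = fderiv ℝ h (extChartAt 𝓘(ℝ, E) x₀ x) (chartD x₀ x u) := by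
  have h1 : g =ᶠ[𝓝 x] h ∘ extChartAt 𝓘(ℝ, E) x₀ := by
    filter_upwards [extChartAt_source_mem_nhds' hx] with z hz using hg z hz
  have h2 := (hh.hasFDerivAt.hasMFDerivAt).comp x
    (mdifferentiableAt_extChartAt (I := 𝓘(ℝ, E)) (mem_chart_source hx)).hasMFDerivAt
  rw [chartD_eq_mfderiv hx, (h2.congr_of_eventuallyEq h1).mfderiv]
  rfl

end Functions

section Sections

variable {σ : ∀ x : M, TangentSpace 𝓘(ℝ, E) x}

theorem trivializationAt_snd (hx : x ∈ (extChartAt 𝓘(ℝ, E) x₀).source)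
    (v : TangentSpace 𝓘(ℝ, E) x) :
    (trivializationAt E (TangentSpace 𝓘(ℝ, E)) x₀ ⟨x, v⟩).2 = chartD x₀ x v := by
  rw [chartD, Trivialization.continuousLinearMapAt_apply,
    Trivialization.coe_linearMapAt_of_mem _ (mem_chart_source hx)]

theorem contMDiffAt_vectorField_iff (hx : x ∈ (extChartAt 𝓘(ℝ, E) x₀).source) :
    ContMDiffAt 𝓘(ℝ, E) (𝓘(ℝ, E).prod 𝓘(ℝ, E)) ∞ (fun z ↦ (⟨z, σ z⟩ : TangentBundle 𝓘(ℝ, E) M)) x ↔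
      ContDiffAt ℝ ∞ (chartField x₀ σ) (extChartAt 𝓘(ℝ, E) x₀ x) := by
  have hc : ∀ z ∈ (extChartAt 𝓘(ℝ, E) x₀).source,
      (trivializationAt E (TangentSpace 𝓘(ℝ, E)) x₀ ⟨z, σ z⟩).2 =
        chartField x₀ σ (extChartAt 𝓘(ℝ, E) x₀ z) := fun z hz ↦ by
    rw [trivializationAt_snd hz, chartField_extChartAt hz]
  refine ((trivializationAt E (TangentSpace 𝓘(ℝ, E)) x₀).contMDiffAt_section_iff
    (mem_chart_source hx)).trans ⟨contDiffAt_of_chart le_rfl hx hc, contMDiffAt_of_chart le_rfl hx hc⟩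

theorem differentiableAt_chartField (hx : x ∈ (extChartAt 𝓘(ℝ, E) x₀).source)
    (hσ : MDifferentiableAt 𝓘(ℝ, E) (𝓘(ℝ, E).prod 𝓘(ℝ, E))
      (fun z ↦ (⟨z, σ z⟩ : TangentBundle 𝓘(ℝ, E) M)) x) :
    DifferentiableAt ℝ (chartField x₀ σ) (extChartAt 𝓘(ℝ, E) x₀ x) := by
  refine differentiableAt_of_chart hx (fun z hz ↦ ?_)
    (((trivializationAt E (TangentSpace 𝓘(ℝ, E)) x₀).mdifferentiableAt_section_iff 𝓘(ℝ, E) σ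
      (mem_chart_source hx)).1 hσ)
  rw [trivializationAt_snd hz, chartField_extChartAt hz]

/-- A field of endomorphisms of the tangent bundle is smooth if its expression in a chart is. -/
theorem contMDiffAt_endomorphism {A : ∀ x : M, TangentSpace 𝓘(ℝ, E) x →L[ℝ] TangentSpace 𝓘(ℝ, E) x}
    {B : E → E →L[ℝ] E} (hx : x ∈ (extChartAt 𝓘(ℝ, E) x₀).source)
    (hA : ∀ z ∈ (extChartAt 𝓘(ℝ, E) x₀).source, ∀ u,
      chartD x₀ z (A z u) = B (extChartAt 𝓘(ℝ, E) x₀ z) (chartD x₀ z u))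
    (hB : ContDiffAt ℝ ∞ B (extChartAt 𝓘(ℝ, E) x₀ x)) :
    ContMDiffAt 𝓘(ℝ, E) (𝓘(ℝ, E).prod 𝓘(ℝ, E →L[ℝ] E)) ∞
      (fun z ↦ (⟨z, A z⟩ : TotalSpace (E →L[ℝ] E)
        fun z : M ↦ TangentSpace 𝓘(ℝ, E) z →L[ℝ] TangentSpace 𝓘(ℝ, E) z)) x := by
  refine ((trivializationAt (E →L[ℝ] E)
    (fun z : M ↦ TangentSpace 𝓘(ℝ, E) z →L[ℝ] TangentSpace 𝓘(ℝ, E) z)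
      x₀).contMDiffAt_section_iff ?_).2 (contMDiffAt_of_chart le_rfl hx (fun z hz ↦ ?_) hB)
  · rw [hom_trivializationAt_baseSet]
    exact ⟨mem_chart_source hx, mem_chart_source hx⟩
  · rw [hom_trivializationAt_apply]
    ext u
    change chartD x₀ z (A z (chartDInv x₀ z u)) = _
    rw [hA z hz, chartD_chartDInv hz]

end Sections

theorem mlieBracket_modelSpace (X Y : E → E) (y : E) :
    mlieBracket 𝓘(ℝ, E) (X : ∀ z : E, TangentSpace 𝓘(ℝ, E) z) Y y =
      fderiv ℝ Y y (X y) - fderiv ℝ X y (Y y) := by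
  refine (congrFun (mlieBracketWithin_univ (I := 𝓘(ℝ, E))
    (V := (X : ∀ z : E, TangentSpace 𝓘(ℝ, E) z)) (W := Y)).symm y).trans
    ((congrFun mlieBracketWithin_eq_lieBracketWithin y).trans ?_)
  exact congrFun (lieBracketWithin_univ (𝕜 := ℝ) (V := X) (W := Y)) y

/-- Naturality of the bracket under pull-back by the inverse chart reduces this to the vector space
formula [X, Y] = DY(X) - DX(Y). -/
theorem chartD_mlieBracket {X Y : ∀ x : M, TangentSpace 𝓘(ℝ, E) x} [CompleteSpace E]
    (hx : x ∈ (extChartAt 𝓘(ℝ, E) x₀).source)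
    (hX : MDifferentiableAt 𝓘(ℝ, E) (𝓘(ℝ, E).prod 𝓘(ℝ, E))
      (fun z ↦ (⟨z, X z⟩ : TangentBundle 𝓘(ℝ, E) M)) x)
    (hY : MDifferentiableAt 𝓘(ℝ, E) (𝓘(ℝ, E).prod 𝓘(ℝ, E))
      (fun z ↦ (⟨z, Y z⟩ : TangentBundle 𝓘(ℝ, E) M)) x) :
    chartD x₀ x (mlieBracket 𝓘(ℝ, E) X Y x) =
      fderiv ℝ (chartField x₀ Y) (extChartAt 𝓘(ℝ, E) x₀ x) (chartD x₀ x (X x)) -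
      fderiv ℝ (chartField x₀ X) (extChartAt 𝓘(ℝ, E) x₀ x) (chartD x₀ x (Y x)) := by
  have hy := (extChartAt 𝓘(ℝ, E) x₀).map_source hx
  have hxy := (extChartAt 𝓘(ℝ, E) x₀).left_inv hx
  have : IsManifold 𝓘(ℝ, E) (minSmoothness ℝ 2) M := by
    rw [minSmoothness_of_isRCLikeNormedField]
    infer_instance
  have key := mpullback_mlieBracket (I := 𝓘(ℝ, E)) (I' := 𝓘(ℝ, E)) (n := ∞)
    (f := (extChartAt 𝓘(ℝ, E) x₀).symm) (V := X) (W := Y) (x₀ := extChartAt 𝓘(ℝ, E) x₀ x)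
    (by rwa [hxy]) (by rwa [hxy])
    ((contMDiffOn_extChartAt_symm (n := ∞) x₀).contMDiffAt (chart_target_mem_nhds hx))
    (by rw [minSmoothness_of_isRCLikeNormedField]; exact WithTop.coe_le_coe.2 (le_top : (2 : ℕ∞) ≤ ⊤))
  rw [← chartField_eq_mpullback _ hy, chartField_extChartAt hx] at key
  have e := fun σ : ∀ x : M, TangentSpace 𝓘(ℝ, E) x ↦
    (show mpullback 𝓘(ℝ, E) 𝓘(ℝ, E) (extChartAt 𝓘(ℝ, E) x₀).symm σ
      =ᶠ[𝓝 (extChartAt 𝓘(ℝ, E) x₀ x)] chartField x₀ σ by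
        filter_upwards [chart_target_mem_nhds hx] with z hz
        exact (chartField_eq_mpullback σ hz).symm)
  rw [key, Filter.EventuallyEq.mlieBracket_vectorField_eq (e X) (e Y)]
  refine (mlieBracket_modelSpace _ _ _).trans ?_
  rw [chartField_extChartAt hx, chartField_extChartAt hx]

end Charts

/-! ### The connection on a chart domain defined by a Christoffel tensor. -/

section ChartConnection

open Set Topology VectorField

variable {E : Type*} [NormedAddCommGroup E] [NormedSpace ℝ E]
  {M : Type*} [TopologicalSpace M] [ChartedSpace E M] [IsManifold 𝓘(ℝ, E) ∞ M]

/-- The connection with Christoffel tensor `Γ` in the preferred chart at `x₀`. -/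
def chartConnection (x₀ : M) (Γ : E → E →L[ℝ] E →L[ℝ] E)
    (σ : ∀ x : M, TangentSpace 𝓘(ℝ, E) x) (x : M) :
    TangentSpace 𝓘(ℝ, E) x →L[ℝ] TangentSpace 𝓘(ℝ, E) x :=
  (chartDInv x₀ x).comp ((fderiv ℝ (chartField x₀ σ) (extChartAt 𝓘(ℝ, E) x₀ x) +
    (Γ (extChartAt 𝓘(ℝ, E) x₀ x)).flip (chartField x₀ σ (extChartAt 𝓘(ℝ, E) x₀ x))).comp
      (chartD x₀ x))

variable {x₀ x : M} {Γ : E → E →L[ℝ] E →L[ℝ] E} {σ : ∀ x : M, TangentSpace 𝓘(ℝ, E) x}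

theorem chartD_chartConnection (hx : x ∈ (extChartAt 𝓘(ℝ, E) x₀).source)
    (u : TangentSpace 𝓘(ℝ, E) x) :
    chartD x₀ x (chartConnection x₀ Γ σ x u) =
      fderiv ℝ (chartField x₀ σ) (extChartAt 𝓘(ℝ, E) x₀ x) (chartD x₀ x u) +
        Γ (extChartAt 𝓘(ℝ, E) x₀ x) (chartD x₀ x u) (chartD x₀ x (σ x)) := by
  simp only [chartConnection, ContinuousLinearMap.comp_apply]
  rw [chartD_chartDInv hx, chartField_extChartAt hx]
  rfl

theorem chartD_injective (hx : x ∈ (extChartAt 𝓘(ℝ, E) x₀).source) :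
    Function.Injective (chartD (E := E) x₀ x) :=
  fun v w h ↦ by
  rw [← chartDInv_chartD hx v, h, chartDInv_chartD hx]

theorem isCovariantDerivativeOn_chartConnection :
    IsCovariantDerivativeOn E (chartConnection x₀ Γ) (extChartAt 𝓘(ℝ, E) x₀).source where
  add {σ σ' x} hσ hσ' hx := by
    have h1 : chartField x₀ (σ + σ') = chartField x₀ σ + chartField x₀ σ' := by
      ext y; exact map_add (chartD _ _) _ _
    ext u
    apply chartD_injective hx
    rw [add_apply, map_add]
    simp only [chartD_chartConnection hx]
    rw [h1, fderiv_add (differentiableAt_chartField hx hσ) (differentiableAt_chartField hx hσ')]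
    simp only [Pi.add_apply, map_add, add_apply]
    abel
  leibniz {σ g x} hσ hg hx := by
    have h1 : chartField x₀ (g • σ) =
        fun y ↦ g ((extChartAt 𝓘(ℝ, E) x₀).symm y) • chartField x₀ σ y := by
      ext y; exact map_smul (chartD _ _) _ _
    have hgc : ∀ z ∈ (extChartAt 𝓘(ℝ, E) x₀).source, g z =
        (fun y ↦ g ((extChartAt 𝓘(ℝ, E) x₀).symm y)) (extChartAt 𝓘(ℝ, E) x₀ z) := fun z hz ↦ by
      simp only [(extChartAt 𝓘(ℝ, E) x₀).left_inv hz]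
    have hgd := differentiableAt_of_chart
      (h := fun y ↦ g ((extChartAt 𝓘(ℝ, E) x₀).symm y)) hx hgc hg
    ext u
    apply chartD_injective hx
    have h2 : mvfderiv 𝓘(ℝ, E) g x u = _ := mfderiv_of_chart
      (h := fun y ↦ g ((extChartAt 𝓘(ℝ, E) x₀).symm y)) hx hgc hgd u
    rw [add_apply, ContinuousLinearMap.smulRight_apply, h2, map_add, map_smul, smul_apply, map_smul]
    simp only [chartD_chartConnection hx]
    rw [h1, fderiv_fun_smul hgd (differentiableAt_chartField hx hσ), chartField_extChartAt hx,
      show g ((extChartAt 𝓘(ℝ, E) x₀).symm (extChartAt 𝓘(ℝ, E) x₀ x)) = g x from (hgc x hx).symm]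
    simp only [Pi.smul_apply', map_smul, add_apply, smul_apply,
      ContinuousLinearMap.smulRight_apply, smul_add]
    abel

theorem contMDiffAt_chartConnection
    (hΓ : ContDiffOn ℝ ∞ Γ (extChartAt 𝓘(ℝ, E) x₀).target)
    (hx : x ∈ (extChartAt 𝓘(ℝ, E) x₀).source)
    (hσ : ContMDiffAt 𝓘(ℝ, E) (𝓘(ℝ, E).prod 𝓘(ℝ, E)) ∞
      (fun z ↦ (⟨z, σ z⟩ : TangentBundle 𝓘(ℝ, E) M)) x) :
    ContMDiffAt 𝓘(ℝ, E) (𝓘(ℝ, E).prod 𝓘(ℝ, E →L[ℝ] E)) ∞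
      (fun z ↦ (⟨z, chartConnection x₀ Γ σ z⟩ : TotalSpace (E →L[ℝ] E)
        fun z : M ↦ TangentSpace 𝓘(ℝ, E) z →L[ℝ] TangentSpace 𝓘(ℝ, E) z)) x := by
  have hσ' := (contMDiffAt_vectorField_iff hx).1 hσ
  refine contMDiffAt_endomorphism
    (B := fun y ↦ fderiv ℝ (chartField x₀ σ) y + (Γ y).flip (chartField x₀ σ y)) hx
    (fun z hz u ↦ ?_) ?_
  · rw [chartD_chartConnection hz, chartField_extChartAt hz]
    rfl
  · refine (hσ'.fderiv_right (by simp)).add (ContDiffAt.clm_apply ?_ hσ')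
    exact (ContinuousLinearMap.flipₗᵢ ℝ E E E).toContinuousLinearEquiv.contDiff.contDiffAt.comp _
      (hΓ.contDiffAt (chart_target_mem_nhds hx))

/-- The Γ terms cancel by symmetry and the derivative terms are the coordinate expression of the
bracket. -/
theorem chartConnection_torsion [CompleteSpace E] {X Y : ∀ x : M, TangentSpace 𝓘(ℝ, E) x}
    (hx : x ∈ (extChartAt 𝓘(ℝ, E) x₀).source)
    (hΓ : ∀ u v, Γ (extChartAt 𝓘(ℝ, E) x₀ x) u v = Γ (extChartAt 𝓘(ℝ, E) x₀ x) v u)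
    (hX : MDifferentiableAt 𝓘(ℝ, E) (𝓘(ℝ, E).prod 𝓘(ℝ, E))
      (fun z ↦ (⟨z, X z⟩ : TangentBundle 𝓘(ℝ, E) M)) x)
    (hY : MDifferentiableAt 𝓘(ℝ, E) (𝓘(ℝ, E).prod 𝓘(ℝ, E))
      (fun z ↦ (⟨z, Y z⟩ : TangentBundle 𝓘(ℝ, E) M)) x) :
    chartConnection x₀ Γ Y x (X x) - chartConnection x₀ Γ X x (Y x) =
      mlieBracket 𝓘(ℝ, E) X Y x := by
  apply chartD_injective hx
  rw [map_sub, chartD_chartConnection hx, chartD_chartConnection hx,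
    chartD_mlieBracket hx hX hY, hΓ]
  abel

theorem chartConnection_eq_zero (hx : x ∈ (extChartAt 𝓘(ℝ, E) x₀).source)
    (h : ∀ u, fderiv ℝ (chartField x₀ σ) (extChartAt 𝓘(ℝ, E) x₀ x) u +
      Γ (extChartAt 𝓘(ℝ, E) x₀ x) u (chartField x₀ σ (extChartAt 𝓘(ℝ, E) x₀ x)) = 0) :
    chartConnection x₀ Γ σ x = 0 := by
  ext u
  apply chartD_injective hx
  rw [chartD_chartConnection hx, ← chartField_extChartAt hx, h]
  simp

/-- By the product rule, D(b(Y, Z)) is (Db)(Y, Z) plus the terms in DY and DZ; `hΓ` turns (Db)(Y, Z)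
into exactly the Γ terms completing them to covariant derivatives. -/
theorem chartConnection_form {Y Z : ∀ x : M, TangentSpace 𝓘(ℝ, E) x}
    {f : ∀ x : M, TangentSpace 𝓘(ℝ, E) x → TangentSpace 𝓘(ℝ, E) x → ℝ}
    {b : E → E →L[ℝ] E →L[ℝ] ℝ} (hx : x ∈ (extChartAt 𝓘(ℝ, E) x₀).source)
    (hf : ∀ z ∈ (extChartAt 𝓘(ℝ, E) x₀).source, ∀ v w,
      f z v w = b (extChartAt 𝓘(ℝ, E) x₀ z) (chartD x₀ z v) (chartD x₀ z w))
    (hb : DifferentiableAt ℝ b (extChartAt 𝓘(ℝ, E) x₀ x))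
    (hΓ : ∀ u v w, fderiv ℝ b (extChartAt 𝓘(ℝ, E) x₀ x) u v w =
      b (extChartAt 𝓘(ℝ, E) x₀ x) (Γ (extChartAt 𝓘(ℝ, E) x₀ x) u v) w +
        b (extChartAt 𝓘(ℝ, E) x₀ x) v (Γ (extChartAt 𝓘(ℝ, E) x₀ x) u w))
    (hY : MDifferentiableAt 𝓘(ℝ, E) (𝓘(ℝ, E).prod 𝓘(ℝ, E))
      (fun z ↦ (⟨z, Y z⟩ : TangentBundle 𝓘(ℝ, E) M)) x)
    (hZ : MDifferentiableAt 𝓘(ℝ, E) (𝓘(ℝ, E).prod 𝓘(ℝ, E))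
      (fun z ↦ (⟨z, Z z⟩ : TangentBundle 𝓘(ℝ, E) M)) x) (u : TangentSpace 𝓘(ℝ, E) x) :
    mfderiv 𝓘(ℝ, E) 𝓘(ℝ, ℝ) (fun z ↦ f z (Y z) (Z z)) x u =
      f x (chartConnection x₀ Γ Y x u) (Z x) + f x (Y x) (chartConnection x₀ Γ Z x u) := by
  have hY' := differentiableAt_chartField hx hY
  have hZ' := differentiableAt_chartField hx hZ
  have hd := (hb.hasFDerivAt.clm_apply hY'.hasFDerivAt).clm_apply hZ'.hasFDerivAt
  have key : fderiv ℝ (fun y ↦ b y (chartField x₀ Y y) (chartField x₀ Z y))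
      (extChartAt 𝓘(ℝ, E) x₀ x) (chartD x₀ x u) =
      f x (chartConnection x₀ Γ Y x u) (Z x) + f x (Y x) (chartConnection x₀ Γ Z x u) := by
    rw [hd.fderiv, hf x hx, hf x hx, chartD_chartConnection hx, chartD_chartConnection hx]
    simp only [chartField_extChartAt hx, add_apply, ContinuousLinearMap.comp_apply,
      ContinuousLinearMap.flip_apply, hΓ, map_add]
    ring
  exact (mfderiv_of_chart (h := fun y ↦ b y (chartField x₀ Y y) (chartField x₀ Z y)) hx
    (fun z hz ↦ by rw [hf z hz, chartField_extChartAt hz, chartField_extChartAt hz])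
    hd.differentiableAt u).trans key

end ChartConnection

/-! ### Averaging chart connections with a partition of unity. -/

section Gluing

open Set Topology VectorField

variable {E : Type*} [NormedAddCommGroup E] [NormedSpace ℝ E]
  {M : Type*} [TopologicalSpace M] [ChartedSpace E M] [IsManifold 𝓘(ℝ, E) ∞ M]
  (ρ : SmoothPartitionOfUnity M 𝓘(ℝ, E) M univ) (Γ : M → E → E →L[ℝ] E →L[ℝ] E)

/-- The sum of the connections with Christoffel tensors `Γ i`, weighted by a partition of unity. -/
def gluedConnection (σ : ∀ x : M, TangentSpace 𝓘(ℝ, E) x) (x : M) :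
    TangentSpace 𝓘(ℝ, E) x →L[ℝ] TangentSpace 𝓘(ℝ, E) x :=
  ∑ᶠ i, ρ i x • chartConnection i (Γ i) σ x

theorem gluedConnection_eq_sum (σ : ∀ x : M, TangentSpace 𝓘(ℝ, E) x) (x : M) :
    gluedConnection ρ Γ σ x = ∑ i ∈ ρ.finsupport x, ρ i x • chartConnection i (Γ i) σ x :=
  (ρ.sum_finsupport_smul_eq_finsum x fun i _ ↦ chartConnection i (Γ i) σ x).symm

theorem gluedConnection_apply (σ : ∀ x : M, TangentSpace 𝓘(ℝ, E) x) (x : M)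
    (u : TangentSpace 𝓘(ℝ, E) x) :
    gluedConnection ρ Γ σ x u =
      ∑ i ∈ ρ.finsupport x, ρ i x • chartConnection i (Γ i) σ x u := by
  simp [gluedConnection_eq_sum]

variable {ρ} {Γ}

omit [IsManifold 𝓘(ℝ, E) ∞ M] in
theorem mem_source_of_mem_finsupport
    (hρ : ρ.IsSubordinate fun i ↦ (extChartAt 𝓘(ℝ, E) i).source) {i x : M}
    (hi : i ∈ ρ.finsupport x) : x ∈ (extChartAt 𝓘(ℝ, E) i).source :=
  hρ i (subset_tsupport _ ((ρ.mem_finsupport x).1 hi))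

/-- A combination of connections with weights of sum 1 is again a connection: the inhomogeneous
Leibniz term dg ⊗ σ must be reproduced exactly once. -/
theorem isCovariantDerivativeOn_gluedConnection
    (hρ : ρ.IsSubordinate fun i ↦ (extChartAt 𝓘(ℝ, E) i).source) :
    IsCovariantDerivativeOn E (gluedConnection ρ Γ) univ where
  add {σ σ' x} hσ hσ' _ := by
    simp only [gluedConnection_eq_sum, ← Finset.sum_add_distrib]
    refine Finset.sum_congr rfl fun i hi ↦ ?_
    rw [isCovariantDerivativeOn_chartConnection.add hσ hσ' (mem_source_of_mem_finsupport hρ hi),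
      smul_add]
  leibniz {σ g x} hσ hg _ := by
    have h1 := ρ.sum_finsupport x (mem_univ x)
    have h2 : ∀ A : TangentSpace 𝓘(ℝ, E) x →L[ℝ] TangentSpace 𝓘(ℝ, E) x,
        A = ∑ i ∈ ρ.finsupport x, ρ i x • A := fun A ↦ by
      rw [← Finset.sum_smul, h1, one_smul]
    rw [h2 ((mvfderiv 𝓘(ℝ, E) g x).smulRight (σ x))]
    simp only [gluedConnection_eq_sum, Finset.smul_sum, ← Finset.sum_add_distrib]
    refine Finset.sum_congr rfl fun i hi ↦ ?_
    rw [isCovariantDerivativeOn_chartConnection.leibniz hσ hg (mem_source_of_mem_finsupport hρ hi),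
      smul_add, smul_comm]

/-- The connection glued from connections in charts. -/
def gluedCovariantDerivative
    (hρ : ρ.IsSubordinate fun i ↦ (extChartAt 𝓘(ℝ, E) i).source)
    (Γ : M → E → E →L[ℝ] E →L[ℝ] E) :
    CovariantDerivative 𝓘(ℝ, E) E (TangentSpace 𝓘(ℝ, E) : M → Type _) :=
  ⟨gluedConnection ρ Γ, isCovariantDerivativeOn_gluedConnection hρ⟩

theorem contMDiff_gluedCovariantDerivative
    (hρ : ρ.IsSubordinate fun i ↦ (extChartAt 𝓘(ℝ, E) i).source)
    (hΓ : ∀ i, ContDiffOn ℝ ∞ (Γ i) (extChartAt 𝓘(ℝ, E) i).target) :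
    (gluedCovariantDerivative hρ Γ).ContMDiffCovariantDerivative ∞ where
  contMDiff.contMDiff {σ} hσ := by
    rw [contMDiffOn_univ] at hσ ⊢
    refine ContMDiff.finsum_section_of_locallyFinite
      (t := fun i x ↦ ρ i x • chartConnection i (Γ i) σ x) ?_ fun i ↦ ?_
    · refine ρ.locallyFinite.subset fun i x hx ↦ ?_
      contrapose! hx
      simp only [Function.mem_support, not_not] at hx
      simp [hx]
    -- Each chart connection is only known to be smooth on its chart domain, which contains the
    -- support of its weight.
    · refine ContMDiffOn.smul_section_of_tsupport (s := chartConnection i (Γ i) σ)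
        (ρ i).contMDiff.contMDiffOn (isOpen_extChartAt_source i) (hρ i) fun x hx ↦ ?_
      exact (contMDiffAt_chartConnection (hΓ i) hx (hσ x)).contMDiffWithinAt

theorem torsion_gluedCovariantDerivative [FiniteDimensional ℝ E] [CompleteSpace E]
    (hρ : ρ.IsSubordinate fun i ↦ (extChartAt 𝓘(ℝ, E) i).source)
    (hΓ : ∀ i, ∀ y ∈ (extChartAt 𝓘(ℝ, E) i).target, ∀ u v, Γ i y u v = Γ i y v u) :
    (gluedCovariantDerivative hρ Γ).torsion = 0 := by
  rw [CovariantDerivative.torsion_eq_zero_iff]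
  intro X Y x hX hY
  change gluedConnection ρ Γ Y x (X x) - gluedConnection ρ Γ X x (Y x) = _
  have h1 := ρ.sum_finsupport x (mem_univ x)
  rw [gluedConnection_apply, gluedConnection_apply, ← Finset.sum_sub_distrib,
    ← one_smul ℝ (mlieBracket 𝓘(ℝ, E) X Y x), ← h1, Finset.sum_smul]
  refine Finset.sum_congr rfl fun i hi ↦ ?_
  have hx := mem_source_of_mem_finsupport hρ hi
  rw [← smul_sub, chartConnection_torsion hx (hΓ i _ ((extChartAt _ i).map_source hx)) hX hY]

theorem gluedConnection_eq_zero {σ : ∀ x : M, TangentSpace 𝓘(ℝ, E) x} {x : M}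
    (hρ : ρ.IsSubordinate fun i ↦ (extChartAt 𝓘(ℝ, E) i).source)
    (h : ∀ i, x ∈ (extChartAt 𝓘(ℝ, E) i).source → chartConnection i (Γ i) σ x = 0) :
    gluedConnection ρ Γ σ x = 0 := by
  rw [gluedConnection_eq_sum]
  exact Finset.sum_eq_zero fun i hi ↦ by
    rw [h i (mem_source_of_mem_finsupport hρ hi), smul_zero]

/-- Compatibility with a bilinear form is an affine condition, with the same constant `c` (the
derivative of the pairing) in every chart; so it survives averaging. -/
theorem gluedConnection_form {Y Z : ∀ x : M, TangentSpace 𝓘(ℝ, E) x} {x : M}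
    (hρ : ρ.IsSubordinate fun i ↦ (extChartAt 𝓘(ℝ, E) i).source)
    (b : TangentSpace 𝓘(ℝ, E) x →ₗ[ℝ] TangentSpace 𝓘(ℝ, E) x →ₗ[ℝ] ℝ)
    (u : TangentSpace 𝓘(ℝ, E) x) (c : ℝ)
    (h : ∀ i, x ∈ (extChartAt 𝓘(ℝ, E) i).source →
      c = b (chartConnection i (Γ i) Y x u) (Z x) + b (Y x) (chartConnection i (Γ i) Z x u)) :
    c = b (gluedConnection ρ Γ Y x u) (Z x) + b (Y x) (gluedConnection ρ Γ Z x u) := by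
  have h1 := ρ.sum_finsupport x (mem_univ x)
  rw [gluedConnection_apply, gluedConnection_apply, map_sum, map_sum, LinearMap.sum_apply,
    ← Finset.sum_add_distrib, ← one_mul c, ← h1, Finset.sum_mul]
  refine Finset.sum_congr rfl fun i hi ↦ ?_
  nth_rewrite 1 [h i (mem_source_of_mem_finsupport hρ hi)]
  simp only [map_smul, LinearMap.smul_apply, smul_eq_mul]
  ring

end Gluing

/-! ### Forms on the model space as bilinear and linear maps. -/

section ModelForms

variable {F : Type*} [NormedAddCommGroup F] [NormedSpace ℝ F] [FiniteDimensional ℝ F]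

/-- The continuous bilinear form of a 2-form. -/
def formBilin (β : F [⋀^Fin 2]→L[ℝ] ℝ) : F →L[ℝ] F →L[ℝ] ℝ :=
  LinearMap.toContinuousLinearMap
    ((LinearMap.toContinuousLinearMap : (F →ₗ[ℝ] ℝ) ≃ₗ[ℝ] (F →L[ℝ] ℝ)).toLinearMap ∘ₗ
      toBilin β.toAlternatingMap)

@[simp]
theorem formBilin_apply (β : F [⋀^Fin 2]→L[ℝ] ℝ) (v w : F) : formBilin β v w = β ![v, w] := rfl

/-- The continuous linear form of a 1-form. -/
def formLin (a : F [⋀^Fin 1]→L[ℝ] ℝ) : F →L[ℝ] ℝ :=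
  LinearMap.toContinuousLinearMap
    { toFun := fun v ↦ a ![v]
      map_add' := fun v w ↦ a.toAlternatingMap.map_vecCons_add ![] v w
      map_smul' := fun c v ↦ a.toAlternatingMap.map_vecCons_smul ![] c v }

variable {T : Set F}

theorem contDiffOn_formBilin {β : F → F [⋀^Fin 2]→L[ℝ] ℝ} (hβ : ContDiffOn ℝ ∞ β T) :
    ContDiffOn ℝ ∞ (fun y ↦ formBilin (β y)) T :=
  contDiffOn_clm_apply.2 fun v ↦ contDiffOn_clm_apply.2 fun w ↦
    (ContinuousAlternatingMap.apply ℝ F ℝ ![v, w]).contDiff.comp_contDiffOn hβ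

theorem contDiffOn_formLin {a : F → F [⋀^Fin 1]→L[ℝ] ℝ} (ha : ContDiffOn ℝ ∞ a T) :
    ContDiffOn ℝ ∞ (fun y ↦ formLin (a y)) T :=
  contDiffOn_clm_apply.2 fun v ↦
    (ContinuousAlternatingMap.apply ℝ F ℝ ![v]).contDiff.comp_contDiffOn ha

omit [FiniteDimensional ℝ F] in
theorem fderiv_alternating_apply {k : ℕ} {β : F → F [⋀^Fin k]→L[ℝ] ℝ} {y : F}
    (hβ : DifferentiableAt ℝ β y) (u : F) (m : Fin k → F) :
    fderiv ℝ (fun z ↦ β z m) y u = fderiv ℝ β y u m := by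
  have h3 : HasFDerivAt (fun z ↦ β z m) _ y :=
    ((ContinuousAlternatingMap.apply ℝ F ℝ m).hasFDerivAt).comp y hβ.hasFDerivAt
  rw [h3.fderiv]
  rfl

theorem fderiv_formBilin {β : F → F [⋀^Fin 2]→L[ℝ] ℝ} (hT : IsOpen T)
    (hβ : ContDiffOn ℝ ∞ β T) {y : F} (hy : y ∈ T) (u v w : F) :
    fderiv ℝ (fun z ↦ formBilin (β z)) y u v w = fderiv ℝ β y u ![v, w] := by
  have h2 := (((contDiffOn_formBilin hβ).contDiffAt (hT.mem_nhds hy)).differentiableAt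
    (by simp)).hasFDerivAt
  have h4 : HasFDerivAt (fun z ↦ β z ![v, w]) _ y :=
    (h2.clm_apply (hasFDerivAt_const v y)).clm_apply (hasFDerivAt_const w y)
  rw [← fderiv_alternating_apply ((hβ.contDiffAt (hT.mem_nhds hy)).differentiableAt (by simp)),
    h4.fderiv]
  simp

theorem cyclic_sum_fderiv_formBilin {β : F → F [⋀^Fin 2]→L[ℝ] ℝ} (hT : IsOpen T)
    (hβ : ContDiffOn ℝ ∞ β T) {y : F} (hy : y ∈ T) (hd : extDeriv β y = 0) (u v w : F) :
    fderiv ℝ (fun z ↦ formBilin (β z)) y u v w + fderiv ℝ (fun z ↦ formBilin (β z)) y v w u +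
      fderiv ℝ (fun z ↦ formBilin (β z)) y w u v = 0 := by
  have h1 := (hβ.contDiffAt (hT.mem_nhds hy)).differentiableAt (by simp)
  have h2 := extDeriv_apply h1 ![u, v, w]
  rw [hd, Fin.sum_univ_three] at h2
  have e0 : (0 : Fin 3).removeNth ![u, v, w] = ![v, w] := by
    ext i; fin_cases i <;> rfl
  have e1 : (1 : Fin 3).removeNth ![u, v, w] = ![u, w] := by
    ext i; fin_cases i <;> rfl
  have e2 : (2 : Fin 3).removeNth ![u, v, w] = ![u, v] := by
    ext i; fin_cases i <;> rfl
  -- The exterior derivative is an alternating sum; skewness turns its middle term -D_vβ(u, w) into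
  -- D_vβ(w, u), making the sum cyclic.
  have h3 : fderiv ℝ β y v ![w, u] = -fderiv ℝ β y v ![u, w] :=
    apply_pair_swap (fderiv ℝ β y v).toAlternatingMap w u
  rw [fderiv_formBilin hT hβ hy, fderiv_formBilin hT hβ hy, fderiv_formBilin hT hβ hy, h3]
  simp [e0, e1, e2, fderiv_alternating_apply h1] at h2
  linarith

end ModelForms

/-! ### Forms on a manifold in charts, and chart independence of closedness. -/

section ManifoldForms

open Set Topology

variable {n : ℕ} {M : Type*} [TopologicalSpace M]
  [ChartedSpace (EuclideanSpace ℝ (Fin n)) M] [IsManifold (𝓡 n) ∞ M] {k : ℕ}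
  (β : DiffForm (n := n) M k) {x₀ : M}

theorem inChart_apply {y : EuclideanSpace ℝ (Fin n)} (hy : y ∈ (extChartAt (𝓡 n) x₀).target)
    (m : Fin k → EuclideanSpace ℝ (Fin n)) :
    β.inChart x₀ y m = β ((extChartAt (𝓡 n) x₀).symm y)
      fun i ↦ chartDInv x₀ ((extChartAt (𝓡 n) x₀).symm y) (m i) := by
  have : (fun i ↦ chartDInv x₀ ((extChartAt (𝓡 n) x₀).symm y) (m i)) = fun i ↦
      mfderiv 𝓘(ℝ, EuclideanSpace ℝ (Fin n)) (𝓡 n) (extChartAt (𝓡 n) x₀).symm y (m i) :=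
    funext fun i ↦ (mfderiv_extChartAt_symm_apply hy (m i)).symm
  rw [this]
  rfl

theorem apply_eq_inChart {x : M} (hx : x ∈ (extChartAt (𝓡 n) x₀).source)
    (m : Fin k → TangentSpace (𝓡 n) x) :
    β x m = β.inChart x₀ (extChartAt (𝓡 n) x₀ x) fun i ↦ chartD x₀ x (m i) := by
  rw [inChart_apply β ((extChartAt (𝓡 n) x₀).map_source hx), (extChartAt (𝓡 n) x₀).left_inv hx]
  simp only [chartDInv_chartD hx]

variable {β}

/-- A form which is closed at every point, in the chart at this point, is closed in all charts. -/
theorem extDeriv_inChart_eq_zero (hβ : DiffForm.IsSmooth β) (hd : ∀ x, DiffForm.extD β x = 0)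
    {y : EuclideanSpace ℝ (Fin n)} (hy : y ∈ (extChartAt (𝓡 n) x₀).target) :
    extDeriv (β.inChart x₀) y = 0 := by
  set x := (extChartAt (𝓡 n) x₀).symm y with hxdef
  have hx : x ∈ (extChartAt (𝓡 n) x₀).source := (extChartAt (𝓡 n) x₀).map_target hy
  have hxx : x ∈ (extChartAt (𝓡 n) x).source := mem_extChartAt_source x
  have hφx := (extChartAt (𝓡 n) x).map_source hxx
  -- `extD` is a pull-back by the differential of the chart at `x`, which is invertible, so its
  -- vanishing can be transported to the model space.
  have hx_zero : extDeriv (β.inChart x) (extChartAt (𝓡 n) x x) = 0 := by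
    ext m
    have h := congrArg (fun l ↦ l fun i ↦ chartDInv x x (m i)) (hd x)
    have e : ∀ v, mfderiv (𝓡 n) 𝓘(ℝ, EuclideanSpace ℝ (Fin n)) (extChartAt (𝓡 n) x) x
        (chartDInv x x v) = v := fun v ↦ by
      rw [← chartD_eq_mfderiv hxx]; exact chartD_chartDInv hxx v
    have e' : (fun i ↦ mfderiv (𝓡 n) 𝓘(ℝ, EuclideanSpace ℝ (Fin n)) (extChartAt (𝓡 n) x) x
        (chartDInv x x (m i))) = m := funext fun i ↦ e (m i)
    refine Eq.trans ?_ h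
    exact congrArg (extDeriv (β.inChart x) (extChartAt (𝓡 n) x x)) e'.symm
  -- The transition map: near `y` the form in the chart at `x₀` is the ψ-pull-back of the form in
  -- the chart at `x`, and the exterior derivative commutes with pull-back.
  let ψ := fun z ↦ extChartAt (𝓡 n) x ((extChartAt (𝓡 n) x₀).symm z)
  have hψy : ψ y = extChartAt (𝓡 n) x x := rfl
  have hsymm : ContMDiffAt 𝓘(ℝ, EuclideanSpace ℝ (Fin n)) (𝓡 n) ∞ (extChartAt (𝓡 n) x₀).symm y :=
    (contMDiffOn_extChartAt_symm (n := ∞) x₀).contMDiffAt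
      ((isOpen_extChartAt_target x₀).mem_nhds hy)
  have hψ : ContDiffAt ℝ ∞ ψ y :=
    ((contMDiffAt_extChartAt' (n := ∞) (I := 𝓡 n) (mem_chart_source hxx)).comp y
      hsymm).contDiffAt
  have hev : β.inChart x₀ =ᶠ[𝓝 y] fun z ↦
      (β.inChart x (ψ z)).compContinuousLinearMap (fderiv ℝ ψ z) := by
    have h1 : ∀ᶠ z in 𝓝 y, (extChartAt (𝓡 n) x₀).symm z ∈ (extChartAt (𝓡 n) x).source :=
      hsymm.continuousAt.eventually ((isOpen_extChartAt_source x).mem_nhds hxx)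
    filter_upwards [h1, (isOpen_extChartAt_target x₀).mem_nhds hy] with z hz hzT
    ext m
    have hD : ∀ v, fderiv ℝ ψ z v = chartD x ((extChartAt (𝓡 n) x₀).symm z)
        (chartDInv x₀ ((extChartAt (𝓡 n) x₀).symm z) v) := fun v ↦ by
      have h2 := (mdifferentiableAt_extChartAt (I := 𝓡 n)
        (mem_chart_source hz)).hasMFDerivAt.comp z
        (((contMDiffOn_extChartAt_symm (n := ∞) x₀).contMDiffAt
          ((isOpen_extChartAt_target x₀).mem_nhds hzT)).mdifferentiableAt
            (by simp)).hasMFDerivAt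
      have h3 : fderiv ℝ ψ z v = mfderiv (𝓡 n) 𝓘(ℝ, EuclideanSpace ℝ (Fin n)) (extChartAt (𝓡 n) x)
          ((extChartAt (𝓡 n) x₀).symm z) (mfderiv 𝓘(ℝ, EuclideanSpace ℝ (Fin n)) (𝓡 n)
            (extChartAt (𝓡 n) x₀).symm z v) :=
        congrArg (fun l : EuclideanSpace ℝ (Fin n) →L[ℝ] EuclideanSpace ℝ (Fin n) ↦ l v)
          (mfderiv_eq_fderiv.symm.trans h2.mfderiv)
      rw [h3, chartD_eq_mfderiv hz, ← mfderiv_extChartAt_symm_apply hzT]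
      rfl
    rw [inChart_apply β hzT, apply_eq_inChart β hz]
    simp only [ContinuousAlternatingMap.compContinuousLinearMap_apply, Function.comp_def, hD]
    rfl
  rw [hev.extDeriv_eq, extDeriv_pullback (r := ∞) ?_ hψ ?_, hψy, hx_zero]
  · rfl
  · exact ((hβ x).contDiffAt ((isOpen_extChartAt_target x).mem_nhds hφx)).differentiableAt (by simp)
  · rw [minSmoothness_of_isRCLikeNormedField]
    exact WithTop.coe_le_coe.2 (le_top : (2 : ℕ∞) ≤ ⊤)

end ManifoldForms

/-! ### The Reeb field and existence of an shs connection. -/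

section Existence

open Set Topology

variable {d : ℕ} {M : Type*} [TopologicalSpace M]
  [ChartedSpace (EuclideanSpace ℝ (Fin (2 * d + 1))) M]
  {Ω : DiffForm (n := 2 * d + 1) M 2} {α : DiffForm (n := 2 * d + 1) M 1}
  {E : ∀ x : M, TangentSpace (𝓡 (2 * d + 1)) x}

instance (x : M) : FiniteDimensional ℝ (TangentSpace (𝓡 (2 * d + 1)) x) :=
  inferInstanceAs (FiniteDimensional ℝ (EuclideanSpace ℝ (Fin (2 * d + 1))))

theorem finrank_tangentSpace (x : M) :
    Module.finrank ℝ (TangentSpace (𝓡 (2 * d + 1)) x) = 2 * d + 1 := by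
  change Module.finrank ℝ (EuclideanSpace ℝ (Fin (2 * d + 1))) = _
  simp

theorem IsStableHamiltonian.eq_zero (h : IsStableHamiltonian Ω α) {x : M}
    (v : TangentSpace (𝓡 (2 * d + 1)) x) (hΩ : ∀ w, Ω x ![v, w] = 0) (hα : α x ![v] = 0) :
    v = 0 :=
  eq_zero_of_wedge_ne_zero (finrank_tangentSpace x) _ _ (h.volume_ne_zero x) v hΩ hα

theorem IsStableHamiltonian.exists_isReebField (h : IsStableHamiltonian Ω α) :
    ∃ E : ∀ x : M, TangentSpace (𝓡 (2 * d + 1)) x, IsReebField Ω α E := by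
  choose E hE using fun x ↦
    exists_reeb_vector (finrank_tangentSpace x) _ _ (h.volume_ne_zero x)
  exact ⟨E, hE⟩

/-- The difference of two Reeb fields lies in ker Ω ∩ ker α = 0. -/
theorem IsReebField.unique (h : IsStableHamiltonian Ω α) (hE : IsReebField Ω α E)
    {E' : ∀ x : M, TangentSpace (𝓡 (2 * d + 1)) x} (hE' : IsReebField Ω α E') (x : M) :
    E' x = E x := by
  rw [← sub_eq_zero]
  refine h.eq_zero _ (fun w ↦ ?_) ?_
  · have h1 : toBilin (Ω x).toAlternatingMap (E' x - E x) w = 0 := by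
      rw [map_sub, LinearMap.sub_apply]
      exact sub_eq_zero.2 (((hE' x).1 w).trans ((hE x).1 w).symm)
    exact h1
  · exact (map_sub (formLin (F := EuclideanSpace ℝ (Fin (2 * d + 1))) (α x)) (E' x) (E x)).trans
      (sub_eq_zero.2 ((hE' x).2.trans (hE x).2.symm))

variable [IsManifold (𝓡 (2 * d + 1)) ∞ M] {x₀ x : M}

theorem apply_pair_eq_inChart (hx : x ∈ (extChartAt (𝓡 (2 * d + 1)) x₀).source)
    (v w : TangentSpace (𝓡 (2 * d + 1)) x) :
    Ω x ![v, w] = formBilin (Ω.inChart x₀ (extChartAt (𝓡 (2 * d + 1)) x₀ x))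
      (chartD x₀ x v) (chartD x₀ x w) := by
  rw [apply_eq_inChart Ω hx]
  exact congrArg _ (funext fun i ↦ by fin_cases i <;> rfl)

theorem apply_single_eq_inChart (hx : x ∈ (extChartAt (𝓡 (2 * d + 1)) x₀).source)
    (v : TangentSpace (𝓡 (2 * d + 1)) x) :
    α x ![v] = formLin (α.inChart x₀ (extChartAt (𝓡 (2 * d + 1)) x₀ x)) (chartD x₀ x v) := by
  rw [apply_eq_inChart α hx]
  exact congrArg _ (funext fun i ↦ by fin_cases i; rfl)

theorem exists_local_christoffel (h : IsStableHamiltonian Ω α) (hE : IsReebField Ω α E) (x₀ : M) :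
    ContDiffOn ℝ ∞ (chartField x₀ E) (extChartAt (𝓡 (2 * d + 1)) x₀).target ∧
    ∃ Γ : EuclideanSpace ℝ (Fin (2 * d + 1)) → EuclideanSpace ℝ (Fin (2 * d + 1)) →L[ℝ]
        EuclideanSpace ℝ (Fin (2 * d + 1)) →L[ℝ] EuclideanSpace ℝ (Fin (2 * d + 1)),
      ContDiffOn ℝ ∞ Γ (extChartAt (𝓡 (2 * d + 1)) x₀).target ∧
      ∀ y ∈ (extChartAt (𝓡 (2 * d + 1)) x₀).target,
        (∀ u v, Γ y u v = Γ y v u) ∧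
        (∀ u, fderiv ℝ (chartField x₀ E) y u + Γ y u (chartField x₀ E y) = 0) ∧
        ∀ u v w, fderiv ℝ (fun z ↦ formBilin (Ω.inChart x₀ z)) y u v w =
          formBilin (Ω.inChart x₀ y) (Γ y u v) w + formBilin (Ω.inChart x₀ y) v (Γ y u w) := by
  have hT := isOpen_extChartAt_target (I := 𝓡 (2 * d + 1)) x₀
  have hsm := h.isHamiltonian.smooth
  refine exists_christoffel (a := fun y ↦ formLin (α.inChart x₀ y)) hT
    (contDiffOn_formBilin (hsm x₀)) (contDiffOn_formLin (h.smooth x₀))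
    (fun y u v ↦ apply_pair_swap (Ω.inChart x₀ y).toAlternatingMap u v)
    (fun y hy ↦ cyclic_sum_fderiv_formBilin hT (hsm x₀) hy
      (extDeriv_inChart_eq_zero hsm h.isHamiltonian.closed hy)) ?_ ?_ ?_
  all_goals
    intro y hy
    have hx := (extChartAt (𝓡 (2 * d + 1)) x₀).map_target hy
    have hxy := (extChartAt (𝓡 (2 * d + 1)) x₀).right_inv hy
    have hΩ := apply_pair_eq_inChart (Ω := Ω) hx
    have hα := apply_single_eq_inChart (α := α) hx
    rw [hxy] at hΩ hα
  · intro v h1 h2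
    have h3 := h.eq_zero (chartDInv x₀ ((extChartAt (𝓡 (2 * d + 1)) x₀).symm y) v)
      (fun w ↦ by rw [hΩ, chartD_chartDInv hx, h1, zero_apply])
      (by rw [hα, chartD_chartDInv hx, h2])
    rw [← chartD_chartDInv hx v, h3, map_zero]
  · ext w
    rw [← chartD_chartDInv hx w]
    exact (hΩ _ _).symm.trans ((hE _).1 _)
  · exact (hα _).symm.trans (hE _).2

theorem IsReebField.contMDiff (h : IsStableHamiltonian Ω α) (hE : IsReebField Ω α E) :
    ContMDiff (𝓡 (2 * d + 1)) ((𝓡 (2 * d + 1)).prod (𝓡 (2 * d + 1))) ∞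
      (fun z ↦ (⟨z, E z⟩ : TangentBundle (𝓡 (2 * d + 1)) M)) := fun x ↦
  (contMDiffAt_vectorField_iff (mem_extChartAt_source x)).2
    ((exists_local_christoffel h hE x).1.contDiffAt
      (chart_target_mem_nhds (mem_extChartAt_source x)))

theorem exists_isShsConnection [T2Space M] [SecondCountableTopology M]
    (h : IsStableHamiltonian Ω α) (hE : IsReebField Ω α E) :
    ∃ nabla : LinearConnection (n := 2 * d + 1) M, IsShsConnection Ω E nabla := by
  -- Second countability and finite dimension give σ-compactness, which is needed for partitions of
  -- unity.
  have : LocallyCompactSpace M := Manifold.locallyCompact_of_finiteDimensional (𝓡 (2 * d + 1))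
  have : SigmaCompactSpace M := sigmaCompactSpace_of_locallyCompact_secondCountable
  obtain ⟨ρ, hρ⟩ := SmoothPartitionOfUnity.exists_isSubordinate (𝓡 (2 * d + 1))
    (isClosed_univ (X := M)) (fun i ↦ (extChartAt (𝓡 (2 * d + 1)) i).source)
    (fun i ↦ isOpen_extChartAt_source i)
    (fun x _ ↦ mem_iUnion.2 ⟨x, mem_extChartAt_source x⟩)
  choose hsm Γ hΓ hΓ' using exists_local_christoffel h hE
  refine ⟨gluedCovariantDerivative hρ Γ, contMDiff_gluedCovariantDerivative hρ hΓ,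
    torsion_gluedCovariantDerivative hρ fun i y hy ↦ (hΓ' i y hy).1, fun x ↦ ?_, fun Y Z x u ↦ ?_⟩
  · exact gluedConnection_eq_zero hρ fun i hx ↦ chartConnection_eq_zero hx
      (hΓ' i _ ((extChartAt _ i).map_source hx)).2.1
  · refine gluedConnection_form hρ (toBilin (Ω x).toAlternatingMap) u _ fun i hx ↦ ?_
    exact chartConnection_form (f := fun z v w ↦ Ω z ![v, w])
      (b := fun y ↦ formBilin (Ω.inChart i y)) hx
      (fun z hz v w ↦ apply_pair_eq_inChart hz v w)
      (((contDiffOn_formBilin (h.isHamiltonian.smooth i)).contDiffAt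
        (chart_target_mem_nhds hx)).differentiableAt (by simp))
      (hΓ' i _ ((extChartAt _ i).map_source hx)).2.2
      ((Y.contMDiff x).mdifferentiableAt (by simp)) ((Z.contMDiff x).mdifferentiableAt (by simp)) u

end Existence

/-! ### A family of shs connections parametrized by the reals. -/

section Infinite

open Set Topology

variable {d : ℕ} {M : Type*} [TopologicalSpace M]
  [ChartedSpace (EuclideanSpace ℝ (Fin (2 * d + 1))) M] [IsManifold (𝓡 (2 * d + 1)) ∞ M]
  {Ω : DiffForm (n := 2 * d + 1) M 2} {α : DiffForm (n := 2 * d + 1) M 1}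
  {E : ∀ x : M, TangentSpace (𝓡 (2 * d + 1)) x}

theorem exists_smoothVectorField [T2Space M] {x : M} (v : TangentSpace (𝓡 (2 * d + 1)) x) :
    ∃ X : SmoothVectorField (n := 2 * d + 1) M, X x = v := by
  obtain ⟨s, hs, hσ⟩ := FiberBundle.exists_contMDiffOn_extend (k := ∞) (𝓡 (2 * d + 1))
    (EuclideanSpace ℝ (Fin (2 * d + 1))) v
  obtain ⟨f, -, hf⟩ := (SmoothBumpFunction.nhds_basis_tsupport (I := 𝓡 (2 * d + 1)) x).mem_iff.1
    (interior_mem_nhds.2 hs)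
  refine ⟨⟨_, ContMDiffOn.smul_section_of_tsupport f.contMDiff.contMDiffOn isOpen_interior hf
    (hσ.mono interior_subset)⟩, ?_⟩
  change f x • FiberBundle.extend (EuclideanSpace ℝ (Fin (2 * d + 1))) v x = v
  rw [f.eq_one, one_smul, FiberBundle.extend_apply_self]

omit [IsManifold (𝓡 (2 * d + 1)) ∞ M] in
-- If Ω vanished at `x`, then α would be injective on a tangent space of dimension 2d + 1 > 1.
theorem IsStableHamiltonian.exists_apply_ne_zero (h : IsStableHamiltonian Ω α) (hd : 0 < d)
    (x : M) : ∃ u w, Ω x ![u, w] ≠ 0 := by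
  by_contra! h0
  have hinj : Function.Injective
      (formLin (F := EuclideanSpace ℝ (Fin (2 * d + 1))) (α x)).toLinearMap := by
    rw [← LinearMap.ker_eq_bot, LinearMap.ker_eq_bot']
    exact fun v hv ↦ h.eq_zero (x := x) v (h0 v) hv
  have := LinearMap.finrank_le_finrank_of_injective hinj
  simp at this
  omega

/-- The 1-form `i_X Ω`. -/
def contraction (Ω : DiffForm (n := 2 * d + 1) M 2) (X : ∀ x : M, TangentSpace (𝓡 (2 * d + 1)) x)
    (x : M) : TangentSpace (𝓡 (2 * d + 1)) x →L[ℝ] ℝ :=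
  formBilin (F := EuclideanSpace ℝ (Fin (2 * d + 1))) (Ω x) (X x)

/-- The connection `∇ + c • (i_X Ω) ⊗ (i_X Ω) ⊗ X`. -/
def perturb (nabla : LinearConnection (n := 2 * d + 1) M) (Ω : DiffForm (n := 2 * d + 1) M 2)
    (X : ∀ x : M, TangentSpace (𝓡 (2 * d + 1)) x) (c : ℝ) : LinearConnection (n := 2 * d + 1) M :=
  nabla.addOneForm fun x ↦
    (c • contraction Ω X x).smulRight ((contraction Ω X x).smulRight (X x))

variable {nabla : LinearConnection (n := 2 * d + 1) M}

theorem perturb_apply (X Y : ∀ x : M, TangentSpace (𝓡 (2 * d + 1)) x) (c : ℝ) (x : M)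
    (u : TangentSpace (𝓡 (2 * d + 1)) x) :
    perturb nabla Ω X c Y x u =
      nabla Y x u + (c * Ω x ![X x, Y x] * Ω x ![X x, u]) • X x := by
  change nabla Y x u + (c * Ω x ![X x, Y x]) • (Ω x ![X x, u]) • X x = _
  rw [smul_smul]

theorem contMDiff_perturb (hΩ : DiffForm.IsSmooth Ω)
    (hn : nabla.ContMDiffCovariantDerivative ∞) (X : SmoothVectorField (n := 2 * d + 1) M) (c : ℝ) :
    (perturb nabla Ω X c).ContMDiffCovariantDerivative ∞ where
  contMDiff.contMDiff {σ} hσ := by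
    have h1 := hn.contMDiff.contMDiff hσ
    rw [contMDiffOn_univ] at hσ h1 ⊢
    refine ContMDiff.add_section h1 (fun x ↦ ?_)
    have hx := mem_extChartAt_source (I := 𝓡 (2 * d + 1)) x
    have hb := (contDiffOn_formBilin (hΩ x)).contDiffAt (chart_target_mem_nhds hx)
    have hX := (contMDiffAt_vectorField_iff hx).1 (X.contMDiff x)
    have hσ' := (contMDiffAt_vectorField_iff hx).1 (hσ x)
    refine contMDiffAt_endomorphism
      (B := fun y ↦ (c * formBilin (Ω.inChart x y) (chartField x X y) (chartField x σ y)) •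
        (formBilin (Ω.inChart x y) (chartField x X y)).smulRight (chartField x X y)) hx
      (fun z hz u ↦ ?_) ?_
    · change chartD x z ((c * Ω z ![X z, σ z]) • (Ω z ![X z, u]) • X z) = _
      rw [map_smul, map_smul, apply_pair_eq_inChart hz, apply_pair_eq_inChart hz,
        ← chartField_extChartAt hz, ← chartField_extChartAt hz]
      rfl
    · exact (contDiffAt_const.mul ((hb.clm_apply hX).clm_apply hσ')).smul
        ((hb.clm_apply hX).smulRight hX)

/-- For the added tensor S, the expression Ω(S(u, Y), Z) = c Ω(X, u) Ω(X, Y) Ω(X, Z) is totally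
symmetric, so Ω(S(u, Y), Z) + Ω(Y, S(u, Z)) = 0. S is symmetric, which preserves the torsion, and
S(u, E) = 0 because Ω(X, E) = 0. -/
theorem isShsConnection_perturb (h : IsStableHamiltonian Ω α) (hE : IsReebField Ω α E)
    (hn : IsShsConnection Ω E nabla) (X : SmoothVectorField (n := 2 * d + 1) M) (c : ℝ) :
    IsShsConnection Ω E (perturb nabla Ω X c) where
  smooth := contMDiff_perturb h.isHamiltonian.smooth hn.smooth X c
  torsion_eq_zero := by
    have h0 := hn.torsion_eq_zero
    rw [CovariantDerivative.torsion_eq_zero_iff] at h0 ⊢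
    intro Y Z x hY hZ
    rw [← h0 hY hZ, perturb_apply, perturb_apply, mul_right_comm]
    abel
  parallel_field x := by
    have h1 : Ω x ![X x, E x] = 0 :=
      (apply_pair_swap (Ω x).toAlternatingMap (X x) (E x)).trans (neg_eq_zero.2 ((hE x).1 _))
    ext1 u
    rw [perturb_apply, hn.parallel_field x, h1]
    simp
  parallel_form Y Z x u := by
    have key : ∀ v, Ω x ![v, X x] = -Ω x ![X x, v] := fun v ↦
      apply_pair_swap (Ω x).toAlternatingMap v (X x)
    refine (hn.parallel_form Y Z x u).trans (?_ : (_ : ℝ) = _)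
    rw [perturb_apply, perturb_apply]
    have e1 : ∀ (v w t : TangentSpace (𝓡 (2 * d + 1)) x) (r : ℝ),
        Ω x ![v + r • w, t] = Ω x ![v, t] + r * Ω x ![w, t] := fun v w t r ↦ by
      simp only [← ContinuousAlternatingMap.coe_toAlternatingMap, ← toBilin_apply, map_add,
        map_smul, LinearMap.add_apply, LinearMap.smul_apply, smul_eq_mul]
    have e2 : ∀ (v w t : TangentSpace (𝓡 (2 * d + 1)) x) (r : ℝ),
        Ω x ![t, v + r • w] = Ω x ![t, v] + r * Ω x ![t, w] := fun v w t r ↦ by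
      simp only [← ContinuousAlternatingMap.coe_toAlternatingMap, ← toBilin_apply, map_add,
        map_smul, smul_eq_mul]
    rw [e1, e2, key]
    ring

theorem infinite_shsConnections [T2Space M] (h : IsStableHamiltonian Ω α) (hE : IsReebField Ω α E)
    (hd : 0 < d) (hn : IsShsConnection Ω E nabla) (x : M) :
    (onSmooth '' {nabla' : LinearConnection (n := 2 * d + 1) M |
      IsShsConnection Ω E nabla'}).Infinite := by
  obtain ⟨u, w, huw⟩ := h.exists_apply_ne_zero hd x
  obtain ⟨X, hX⟩ := exists_smoothVectorField u
  obtain ⟨Y, hY⟩ := exists_smoothVectorField w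
  have hu : u ≠ 0 := by
    rintro rfl
    exact huw ((LinearMap.congr_fun (map_zero (toBilin (Ω x).toAlternatingMap)) w :))
  -- With X = u and Y = w at `x`, the derivative of `Y` along `w` changes by c Ω(u, w)² u, which
  -- determines c.
  refine infinite_of_injective_forall_mem (f := fun c : ℝ ↦ onSmooth (perturb nabla Ω X c))
    (fun c c' hc ↦ ?_) fun c ↦ ⟨_, isShsConnection_perturb h hE hn X c, rfl⟩
  have h1 : perturb nabla Ω X c Y x w = perturb nabla Ω X c' Y x w :=
    congrArg (fun l ↦ l w) (congrFun (congrFun hc Y) x)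
  rw [perturb_apply, perturb_apply, add_right_inj, hX, hY] at h1
  have h2 := smul_left_injective ℝ hu h1
  exact mul_right_cancel₀ huw (mul_right_cancel₀ huw h2)

end Infinite

end StableHamiltonian

end

theorem mainTheorem2 (d : ℕ) (M : Type*) [TopologicalSpace M] [T2Space M]
    [SecondCountableTopology M] [ChartedSpace (EuclideanSpace ℝ (Fin (2 * d + 1))) M]
    [IsManifold (𝓡 (2 * d + 1)) ∞ M]
    (Ω : StableHamiltonian.DiffForm (n := 2 * d + 1) M 2)
    (α : StableHamiltonian.DiffForm (n := 2 * d + 1) M 1)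
    (h : StableHamiltonian.IsStableHamiltonian Ω α) :
    ∃ E : StableHamiltonian.SmoothVectorField (n := 2 * d + 1) M,
      StableHamiltonian.IsReebField Ω α E ∧
      (∀ E' : ∀ x : M, TangentSpace (𝓡 (2 * d + 1)) x,
        StableHamiltonian.IsReebField Ω α E' → ∀ x, E' x = E x) ∧
      (∃ nabla : StableHamiltonian.LinearConnection (n := 2 * d + 1) M,
        StableHamiltonian.IsShsConnection Ω E nabla) ∧
      (0 < d → Nonempty M →
        (StableHamiltonian.onSmooth ''
          {nabla : StableHamiltonian.LinearConnection (n := 2 * d + 1) M |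
            StableHamiltonian.IsShsConnection Ω E nabla}).Infinite) ∧
      (Ω = StableHamiltonian.DiffForm.extD α → ∀ nabla : StableHamiltonian.LinearConnection (n := 2 * d + 1) M,
        StableHamiltonian.IsShsConnection Ω E nabla ↔
          StableHamiltonian.IsContactConnection α E nabla) := by
  obtain ⟨E, hE⟩ := h.exists_isReebField
  obtain ⟨nabla, hn⟩ := StableHamiltonian.exists_isShsConnection h hE
  refine ⟨⟨E, hE.contMDiff h⟩, hE, fun E' hE' ↦ hE.unique h hE', ⟨nabla, hn⟩,
    fun hd ⟨x⟩ ↦ StableHamiltonian.infinite_shsConnections h hE hd hn x, ?_⟩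
  -- Once Ω is replaced by dα, both structures have the same four fields.
  rintro rfl nabla
  exact ⟨fun ⟨h1, h2, h3, h4⟩ ↦ ⟨h1, h2, h3, h4⟩, fun ⟨h1, h2, h3, h4⟩ ↦ ⟨h1, h2, h3, h4⟩⟩
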